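/- Let $R=\mathbb R[[t]]$ with maximal ideal $\mathfrak m=(t)$, write $p(0)$ for the constant term of $p\in R$, and let $A$ (the real Gelfand order) be the $\mathbb R$-algebra of all matrices $a=(a_{ij})\in M_3(R)$ with $a_{13},a_{23}\in\mathfrak m$, $a_{11}(0)=a_{22}(0)$ and $a_{21}(0)=-a_{12}(0)$. Let $\mathsf{Rep}(A)$ be the category of $A$-modules that are finite dimensional over $\mathbb R$; an object $M$ is called Schurian if $\mathrm{End}_A(M)$ is a division algebra. With $e=E_{11}+E_{22}$ and $f=E_{33}$, the dimension vector of $M$ is $\bigl(\tfrac12\dim_{\mathbb R}eM,\ \dim_{\mathbb R}fM\bigr)$. Let $U,V$ be finite dimensional real vector spaces and let $Y=\binom{Y_1}{Y_2}\colon V\to U\oplus U$ and $X=(X_1\ X_2)\colon U\oplus U\to V$ be linear maps, at least one of which is zero. Put $J(u_1,u_2)=(-u_2,u_1)$. We denote by $\bigl[V\underset{X}{\overset{Y}{\rightleftarrows}}U\oplus U\bigr]$ the $A$-module $(U\oplus U)\oplus V$ on which $a\in A$ acts by $$a\cdot(w,v)=\bigl(\alpha w+\beta Jw+c_1Yv+c_2JYv,\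 \ b_1Xw-b_2XJw+\rho v\bigr),$$ where $\alpha=a_{11}(0)$, $\beta=a_{21}(0)$, $b_j=a_{3j}(0)$, $\rho=a_{33}(0)$, and $c_i$ is the coefficient of $t$ in $a_{i3}$. (So $E_{21}-E_{12}$ acts on $eM=U\oplus U$ by $J$, the element $tE_{13}$ acts by $Y\colon fM\to eM$, and $E_{31}$ acts by $X\colon eM\to fM$.) **Theorem.** Up to isomorphism, $\mathsf{Rep}(A)$ contains precisely six Schurian objects; that is, the following six modules are Schurian and pairwise non-isomorphic, and every Schurian object of $\mathsf{Rep}(A)$ is isomorphic to one of them. (a) Two simple modules $S$ ($U=\mathbb R$, $V=0$) and $T$ ($U=0$, $V=\mathbb R$), of dimension vectors $(1,0)$ and $(0,1)$, respectively. (b) Two modules of length two, with $U=V=\mathbb R$: one with $Y=\binom{1}{0}$, $X=0$, and one with $Y=0$, $X=(1\ \ 0)$. Their endomorphism algebras are isomorphic to $\mathbb R$. (c) Two modules of length three, with $U=\mathbb R$, $V=\mathbb R^2$: one with $Y=\begin{pmatrix}1&0\\0&1\end{pmatrix}$, $X=0$, and one with $Y=0$, $X=\begin{pmatrix}1&0\\0&1\end{pmatrix}$.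 Their endomorphism algebras are isomorphic to $\mathbb C$. -/

import Mathlib

open scoped PowerSeries

noncomputable section

namespace RealGelfand

/-- The ring of formal power series `R = ℝ⟦t⟧`; its maximal ideal `𝔪 = (t)` consists of the
series with vanishing constant coefficient. -/
abbrev R : Type := ℝ⟦X⟧

/-- The value `p(0)` of a power series. -/
abbrev ev0 : R →+* ℝ := PowerSeries.constantCoeff

/-- The real Gelfand order: all matrices over `ℝ⟦t⟧` whose entries `(1,3)` and `(2,3)` lie in `𝔪`
and which satisfy `a₁₁(0) = a₂₂(0)`, `a₂₁(0) = -a₁₂(0)`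
(rows and columns are numbered from `0` in the code). -/
def order : Subalgebra ℝ (Matrix (Fin 3) (Fin 3) R) where
  carrier := {a | ev0 (a 0 2) = 0 ∧ ev0 (a 1 2) = 0 ∧
    ev0 (a 0 0) = ev0 (a 1 1) ∧ ev0 (a 1 0) = - ev0 (a 0 1)}
  mul_mem' := by
    rintro a b ⟨h1, h2, h3, h4⟩ ⟨k1, k2, k3, k4⟩
    simp only [Set.mem_ofPred_eq, Matrix.mul_apply, Fin.sum_univ_three, map_add, map_mul,
      h1, h2, h3, h4, k1, k2, k3, k4]
    refine ⟨?_, ?_, ?_, ?_⟩ <;> ring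
  add_mem' := by
    rintro a b ⟨h1, h2, h3, h4⟩ ⟨k1, k2, k3, k4⟩
    simp only [Set.mem_ofPred_eq, Matrix.add_apply, map_add, h1, h2, h3, h4, k1, k2, k3, k4]
    refine ⟨by ring, by ring, trivial, by ring⟩
  algebraMap_mem' := by
    intro r
    simp [Matrix.algebraMap_matrix_apply]

/-- The real Gelfand order as a type. -/
abbrev A : Type := order

/-- The idempotent `e = E₁₁ + E₂₂`. -/
def idemE : A := ⟨!![1, 0, 0; 0, 1, 0; 0, 0, 0], by simp [order]⟩

/-- The idempotent `f = E₃₃`. -/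
def idemF : A := ⟨!![0, 0, 0; 0, 0, 0; 0, 0, 1], by simp [order]⟩

/-! ### Evaluating power series at a nilpotent endomorphism -/

section NilEval

variable {V : Type*} [AddCommGroup V] [Module ℝ V]

theorem aeval_trunc_eq {N : ℕ} {τ : Module.End ℝ V} (h : τ ^ N = 0) (p : R)
    (P : Polynomial ℝ) (hP : ∀ d < N, P.coeff d = PowerSeries.coeff d p) :
    Polynomial.aeval τ (PowerSeries.trunc N p) = Polynomial.aeval τ P := by
  have hd : (Polynomial.X : Polynomial ℝ) ^ N ∣ PowerSeries.trunc N p - P := by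
    rw [Polynomial.X_pow_dvd_iff]
    intro d hd
    rw [Polynomial.coeff_sub, PowerSeries.coeff_trunc, if_pos hd, hP d hd, sub_self]
  obtain ⟨Q, hQ⟩ := hd
  rw [← sub_eq_zero, ← map_sub, hQ, map_mul, map_pow, Polynomial.aeval_X, h, zero_mul]

/-- `p ↦ p(τ) = ∑ₙ pₙ τⁿ` for a nilpotent endomorphism `τ`; the sum is finite. -/
def nilEval (τ : Module.End ℝ V) (hτ : IsNilpotent τ) : R →ₐ[ℝ] Module.End ℝ V where
  toFun p := Polynomial.aeval τ (PowerSeries.trunc (nilpotencyClass τ) p)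
  map_one' := by
    rw [aeval_trunc_eq (pow_nilpotencyClass hτ) 1 1 (by
      intro d _; simp [Polynomial.coeff_one, PowerSeries.coeff_one]), map_one]
  map_mul' p q := by
    rw [aeval_trunc_eq (pow_nilpotencyClass hτ) (p * q)
      (PowerSeries.trunc (nilpotencyClass τ) p * PowerSeries.trunc (nilpotencyClass τ) q), map_mul]
    intro d hd
    rw [PowerSeries.coeff_mul_eq_coeff_trunc_mul_trunc p q hd]
    rw [← Polynomial.coeff_coe, Polynomial.coe_mul]
  map_zero' := by simp
  map_add' p q := by simp
  commutes' r := by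
    rw [aeval_trunc_eq (pow_nilpotencyClass hτ) _ (Polynomial.C r) (by
      intro d _
      rw [Polynomial.coeff_C, PowerSeries.algebraMap_apply, PowerSeries.coeff_C]
      simp), Polynomial.aeval_C]

theorem nilEval_X (τ : Module.End ℝ V) (hτ : IsNilpotent τ) :
    nilEval τ hτ PowerSeries.X = τ := by
  change Polynomial.aeval τ (PowerSeries.trunc (nilpotencyClass τ) PowerSeries.X) = τ
  rw [aeval_trunc_eq (pow_nilpotencyClass hτ) _ Polynomial.X (by
    intro d _; simp [Polynomial.coeff_X, PowerSeries.coeff_X, eq_comm]), Polynomial.aeval_X]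

end NilEval

/-- `(p - p(0)) / t`. -/
def shift : R →ₗ[ℝ] R where
  toFun p := PowerSeries.mk fun n => PowerSeries.coeff (n + 1) p
  map_add' p q := by ext n; simp
  map_smul' c p := by ext n; simp

theorem eq_shift (p : R) : p = PowerSeries.X * shift p + algebraMap ℝ R (ev0 p) :=
  PowerSeries.eq_X_mul_shift_add_const p

theorem shift_unique {p q : R} {c : ℝ} (h : p = PowerSeries.X * q + algebraMap ℝ R c) :
    shift p = q := by
  ext n
  simp [shift, h, PowerSeries.coeff_succ_X_mul]

theorem shift_mul (p q : R) : shift (p * q) =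
    ev0 p • shift q + ev0 q • shift p + PowerSeries.X * (shift p * shift q) := by
  apply shift_unique (c := ev0 p * ev0 q)
  conv_lhs => rw [eq_shift p, eq_shift q]
  simp only [Algebra.smul_def, map_mul]
  ring

theorem shift_mul_of_ev0_eq_zero {p : R} (hp : ev0 p = 0) (q : R) :
    shift (p * q) = shift p * q := by
  rw [shift_mul, hp, zero_smul, zero_add]
  conv_rhs => rw [eq_shift q]
  rw [Algebra.smul_def]
  ring

section Identities

variable {K V : Type*} [CommRing K] [Algebra ℝ K] [AddCommGroup V] [Module ℝ V] [Module K V]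
  [IsScalarTower ℝ K V]

theorem lower_row (t a0 a1 a2 s00 s01 s02 s10 s11 s12 b20 b21 b22 : K) (c d : ℝ) (p q v : V) :
    (a0 * (t * s00 + algebraMap ℝ K c) + a1 * (t * s10 + algebraMap ℝ K d) + a2 * b20) • p
      + (a0 * (t * s01 + algebraMap ℝ K (-d)) + a1 * (t * s11 + algebraMap ℝ K c) + a2 * b21) • -q
      + (a0 * (t * s02 + algebraMap ℝ K 0) + a1 * (t * s12 + algebraMap ℝ K 0) + a2 * b22) • v
    = a0 • (c • p + d • q + t • (s00 • p + s01 • -q + s02 • v))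
      + a1 • -(c • q - d • p - t • (s10 • p + s11 • -q + s12 • v))
      + a2 • (b20 • p + b21 • -q + b22 • v) := by
  simp only [map_neg, map_zero, ← algebraMap_smul K c, ← algebraMap_smul K d]
  module

theorem upper_row (t s0 s1 s2 s00 s01 s02 s10 s11 s12 b20 b21 b22 : K) (α β c d : ℝ)
    (p q v : V) :
    ((α • s00 + c • s0 + t * (s0 * s00)) + (β • s10 + d • s1 + t * (s1 * s10)) + s2 * b20) • p
      + ((α • s01 + (-d) • s0 + t * (s0 * s01)) + (β • s11 + c • s1 + t * (s1 * s11))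
        + s2 * b21) • -q
      + ((α • s02 + (0 : ℝ) • s0 + t * (s0 * s02)) + (β • s12 + (0 : ℝ) • s1 + t * (s1 * s12))
        + s2 * b22) • v
    = α • (s00 • p + s01 • -q + s02 • v) + β • (s10 • p + s11 • -q + s12 • v)
      + (s0 • (c • p + d • q + t • (s00 • p + s01 • -q + s02 • v))
        + s1 • -(c • q - d • p - t • (s10 • p + s11 • -q + s12 • v))
        + s2 • (b20 • p + b21 • -q + b22 • v)) := by
  simp only [Algebra.smul_def, ← algebraMap_smul K c, ← algebraMap_smul K d, map_neg, map_zero,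
    ← algebraMap_smul K α (_ : V), ← algebraMap_smul K β (_ : V)]
  module

end Identities

/-! ### Modules given by diagrams of linear maps -/

/-- Linear algebra data for an `A`-module: finite dimensional real vector spaces `U`, `V` and
linear maps `Y = (Y₁, Y₂)ᵗ : V → U ⊕ U` and `X = (X₁, X₂) : U ⊕ U → V`, which describe the action
of `y₁ = tE₁₃` and of `x₁ = E₃₁`, while `ȷ = E₂₁ - E₁₂` acts on `U ⊕ U` by
`(u₁, u₂) ↦ (-u₂, u₁)`. The first relation says that `x₁ȷy₁ = 0`, the second one that
`x₁y₁ = tE₃₃` is nilpotent. -/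
structure Diagram where
  U : Type
  V : Type
  [groupU : AddCommGroup U]
  [moduleU : Module ℝ U]
  [finU : FiniteDimensional ℝ U]
  [groupV : AddCommGroup V]
  [moduleV : Module ℝ V]
  [finV : FiniteDimensional ℝ V]
  X₁ : U →ₗ[ℝ] V
  X₂ : U →ₗ[ℝ] V
  Y₁ : V →ₗ[ℝ] U
  Y₂ : V →ₗ[ℝ] U
  rel : X₁ ∘ₗ Y₂ = X₂ ∘ₗ Y₁
  nilp : IsNilpotent (X₁ ∘ₗ Y₁ + X₂ ∘ₗ Y₂ : Module.End ℝ V)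

namespace Diagram

attribute [instance] groupU moduleU finU groupV moduleV finV

variable (D : Diagram)

/-- The complex structure `(u₁, u₂) ↦ (-u₂, u₁)` on `U ⊕ U`. -/
def J : (D.U × D.U) →ₗ[ℝ] (D.U × D.U) :=
  (-LinearMap.snd ℝ D.U D.U).prod (LinearMap.fst ℝ D.U D.U)

/-- The row `X = (X₁, X₂) : U ⊕ U → V`. -/
def X : (D.U × D.U) →ₗ[ℝ] D.V := D.X₁.coprod D.X₂

/-- The column `Y = (Y₁, Y₂)ᵗ : V → U ⊕ U`. -/
def Y : D.V →ₗ[ℝ] (D.U × D.U) := D.Y₁.prod D.Y₂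

/-- The action of `x₁ = E₃₁` (by `X`) and of `x₂ = E₃₂ = -x₁ȷ`, where `ȷ = E₂₁ - E₁₂`
acts on `U ⊕ U` by `J`. -/
def x : Fin 2 → ((D.U × D.U) →ₗ[ℝ] D.V) := ![D.X, -(D.X ∘ₗ D.J)]

/-- The action of `y₁ = tE₁₃` (by `Y`) and of `y₂ = tE₂₃ = ȷy₁`. -/
def y : Fin 2 → (D.V →ₗ[ℝ] (D.U × D.U)) := ![D.Y, D.J ∘ₗ D.Y]

/-- The action of `t` on `V`, that is, of `x₁y₁ = x₂y₂ = tE₃₃`. -/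
def τ : Module.End ℝ D.V := D.X₁ ∘ₗ D.Y₁ + D.X₂ ∘ₗ D.Y₂

/-- The action of a power series on `V`. -/
def ev : R →ₐ[ℝ] Module.End ℝ D.V := nilEval D.τ D.nilp

/-- The underlying real vector space `U ⊕ U ⊕ V` of the `A`-module given by a diagram. -/
def Mod : Type := (D.U × D.U) × D.V

instance : AddCommGroup D.Mod := inferInstanceAs (AddCommGroup ((D.U × D.U) × D.V))
instance : Module ℝ D.Mod := inferInstanceAs (Module ℝ ((D.U × D.U) × D.V))
instance : FiniteDimensional ℝ D.Mod :=
  inferInstanceAs (FiniteDimensional ℝ ((D.U × D.U) × D.V))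

/-- The `U ⊕ U`-component of the action of a matrix `a`. The constant part of its upper left
`2 × 2`-block acts by `a₁₁(0) + a₂₁(0) J`; moreover
`tⁿ⁺¹Eᵢⱼ = yᵢ tⁿ xⱼ` and `tⁿ⁺¹Eᵢ₃ = yᵢ tⁿ` for `i, j ≤ 2`. -/
def actW (a : A) (m : (D.U × D.U) × D.V) : D.U × D.U :=
  ev0 (a.1 0 0) • m.1 + ev0 (a.1 1 0) • D.J m.1
    + ∑ i : Fin 2, D.y i (∑ j : Fin 2, D.ev (shift (a.1 i.castSucc j.castSucc)) (D.x j m.1)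
      + D.ev (shift (a.1 i.castSucc 2)) m.2)

/-- The `V`-component of the action of a matrix `a`: here `tⁿE₃ⱼ = tⁿ xⱼ` for `j ≤ 2`. -/
def actV (a : A) (m : (D.U × D.U) × D.V) : D.V :=
  ∑ j : Fin 2, D.ev (a.1 2 j.castSucc) (D.x j m.1) + D.ev (a.1 2 2) m.2

/-- The action of a matrix `a` on `U ⊕ U ⊕ V`. -/
def act (a : A) (m : D.Mod) : D.Mod := (D.actW a m, D.actV a m)

theorem J_J (w : D.U × D.U) : D.J (D.J w) = -w := by
  simp [J, Prod.ext_iff]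

theorem X_Y (v : D.V) : D.X (D.Y v) = D.τ v := by
  simp [X, Y, τ]

theorem X_J_Y (v : D.V) : D.X (D.J (D.Y v)) = 0 := by
  have h := LinearMap.congr_fun D.rel v
  simp only [LinearMap.comp_apply] at h
  simp [X, Y, J, h]

theorem act_one (m : D.Mod) : D.act 1 m = m := by
  have h1 : shift 1 = 0 := shift_unique (c := 1) (by simp)
  refine Prod.ext ?_ ?_
  · simp [act, actW, Fin.sum_univ_two, Matrix.one_apply, h1]
  · simp [act, actV, Fin.sum_univ_two, Matrix.one_apply]

theorem act_add (a : A) (m m' : D.Mod) : D.act a (m + m') = D.act a m + D.act a m' := by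
  have h1 : (m + m').1 = m.1 + m'.1 := rfl
  have h2 : (m + m').2 = m.2 + m'.2 := rfl
  refine Prod.ext ?_ ?_
  · change D.actW a (m + m') = D.actW a m + D.actW a m'
    simp only [actW, Fin.sum_univ_two, h1, h2, map_add]
    module
  · change D.actV a (m + m') = D.actV a m + D.actV a m'
    simp only [actV, Fin.sum_univ_two, h1, h2, map_add]
    module

theorem add_act (a b : A) (m : D.Mod) : D.act (a + b) m = D.act a m + D.act b m := by
  refine Prod.ext ?_ ?_
  · change D.actW (a + b) m = D.actW a m + D.actW b m
    simp only [actW, Fin.sum_univ_two, Subalgebra.coe_add, Matrix.add_apply, map_add,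
      LinearMap.add_apply]
    module
  · change D.actV (a + b) m = D.actV a m + D.actV b m
    simp only [actV, Fin.sum_univ_two, Subalgebra.coe_add, Matrix.add_apply, map_add,
      LinearMap.add_apply]
    module

theorem smul_act (c : ℝ) (a : A) (m : D.Mod) : D.act (c • a) m = c • D.act a m := by
  refine Prod.ext ?_ ?_
  · change D.actW (c • a) m = c • D.actW a m
    simp only [actW, Fin.sum_univ_two, Subalgebra.coe_smul, Matrix.smul_apply, map_smul, map_add,
      LinearMap.smul_apply, PowerSeries.constantCoeff_smul]
    module
  · change D.actV (c • a) m = c • D.actV a m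
    simp only [actV, Fin.sum_univ_two, Subalgebra.coe_smul, Matrix.smul_apply, map_smul,
      LinearMap.smul_apply]
    module

/-- `V` as a module over `ℝ⟦t⟧`. -/
abbrev moduleRV : Module R D.V := Module.compHom D.V D.ev.toRingHom

theorem act_mul (a b : A) (m : D.Mod) : D.act (a * b) m = D.act a (D.act b m) := by
  obtain ⟨w, v⟩ := m
  obtain ⟨ha1, ha2, ha3, ha4⟩ := a.2
  obtain ⟨hb1, hb2, hb3, hb4⟩ := b.2
  have ha4' : ev0 (a.1 0 1) = -ev0 (a.1 1 0) := by rw [ha4, neg_neg]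
  have hb4' : ev0 (b.1 0 1) = -ev0 (b.1 1 0) := by rw [hb4, neg_neg]
  let _ : Module R D.V := D.moduleRV
  have hev : ∀ (p : R) (v : D.V), D.ev p v = p • v := fun _ _ => rfl
  have _ : IsScalarTower ℝ R D.V := ⟨fun c p v => by
    rw [← hev, ← hev, map_smul, LinearMap.smul_apply]⟩
  have hτ : ∀ v, D.τ v = (PowerSeries.X : R) • v := fun v => by
    rw [← hev]; exact congrArg (fun g : Module.End ℝ D.V => g v) (nilEval_X _ D.nilp).symm
  have hmul : ∀ i k, (a * b).1 i k =
      a.1 i 0 * b.1 0 k + a.1 i 1 * b.1 1 k + a.1 i 2 * b.1 2 k := fun i k => by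
    rw [Subalgebra.coe_mul, Matrix.mul_apply, Fin.sum_univ_three]
  have hc1 : Fin.castSucc (1 : Fin 2) = (1 : Fin 3) := rfl
  have hc0 : Fin.castSucc (0 : Fin 2) = (0 : Fin 3) := rfl
  have hx0 : ∀ (α β : ℝ) (p q : D.V), D.X (α • w + β • D.J w + (D.Y p + D.J (D.Y q))) =
      α • D.X w + β • D.X (D.J w) + (PowerSeries.X : R) • p := fun α β p q => by
    simp only [map_add, map_smul, X_Y, X_J_Y, hτ, add_zero]
  have hx1 : ∀ (α β : ℝ) (p q : D.V), D.X (D.J (α • w + β • D.J w + (D.Y p + D.J (D.Y q)))) =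
      α • D.X (D.J w) - β • D.X w - (PowerSeries.X : R) • q := fun α β p q => by
    simp only [map_add, map_smul, X_Y, X_J_Y, J_J, hτ, map_neg, zero_add, smul_neg,
      sub_eq_add_neg]
  refine Prod.ext ?_ ?_
  · change D.actW _ (w, v) = D.actW _ (D.actW _ (w, v), D.actV _ (w, v))
    simp only [actV, actW, x, y, Fin.sum_univ_two,
      Matrix.cons_val_zero, Matrix.cons_val_one, hc0, hc1, hev,
      LinearMap.neg_apply, LinearMap.comp_apply, hx0, hx1]
    have key : ∀ (α β α' β' : ℝ) (P0 P1 Q0 Q1 : D.V),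
        α • (α' • w + β' • D.J w + (D.Y P0 + D.J (D.Y P1)))
          + β • D.J (α' • w + β' • D.J w + (D.Y P0 + D.J (D.Y P1))) + (D.Y Q0 + D.J (D.Y Q1))
        = (α * α' - β * β') • w + (β * α' + α * β') • D.J w
          + (D.Y (α • P0 + (-β) • P1 + Q0) + D.J (D.Y (β • P0 + α • P1 + Q1))) := by
      intro α β α' β' P0 P1 Q0 Q1
      simp only [map_add, map_smul, J_J]
      module
    rw [key, ← upper_row, ← upper_row]
    simp only [hmul, map_add, map_mul, shift_mul_of_ev0_eq_zero ha1, shift_mul_of_ev0_eq_zero ha2,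
      shift_mul (a.1 0 0), shift_mul (a.1 0 1), shift_mul (a.1 1 0), shift_mul (a.1 1 1),
      ha1, ha2, ← ha3, ha4', hb1, hb2, ← hb3, hb4']
    congr 3 <;> ring
  · change D.actV _ (w, v) = D.actV _ (D.actW _ (w, v), D.actV _ (w, v))
    simp only [actV, actW, x, y, Fin.sum_univ_two,
      Matrix.cons_val_zero, Matrix.cons_val_one, hc0, hc1, hev,
      LinearMap.neg_apply, LinearMap.comp_apply, hx0, hx1]
    have h00 := (eq_shift (b.1 0 0)).symm
    have h01 := (eq_shift (b.1 0 1)).symm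
    have h02 := (eq_shift (b.1 0 2)).symm
    have h10 := (eq_shift (b.1 1 0)).symm
    have h11 := (eq_shift (b.1 1 1)).symm
    have h12 := (eq_shift (b.1 1 2)).symm
    rw [hb4'] at h01
    rw [hb1] at h02
    rw [← hb3] at h11
    rw [hb2] at h12
    rw [← lower_row, hmul, hmul, hmul, h00, h01, h02, h10, h11, h12]

/-- The `A`-module given by a diagram. -/
instance : Module A D.Mod where
  smul := D.act
  one_smul := D.act_one
  mul_smul := D.act_mul
  smul_add := D.act_add
  add_smul := D.add_act
  smul_zero a := by
    change D.act a 0 = 0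
    simpa using D.act_add a 0 0
  zero_smul m := by
    change D.act 0 m = 0
    simpa using D.add_act 0 0 m

instance : IsScalarTower ℝ A D.Mod := ⟨fun c a m => D.smul_act c a m⟩

end Diagram

/-! ### The six diagrams -/

/-- `U = ℝ`, `V = 0`. -/
def diagS : Diagram where
  U := ℝ
  V := PUnit
  X₁ := 0
  X₂ := 0
  Y₁ := 0
  Y₂ := 0
  rel := by simp
  nilp := by simp

/-- `U = 0`, `V = ℝ`. -/
def diagT : Diagram where
  U := PUnit
  V := ℝ
  X₁ := 0
  X₂ := 0
  Y₁ := 0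
  Y₂ := 0
  rel := by simp
  nilp := by simp

/-- `U = V = ℝ`, `Y = (1, 0)ᵗ`, `X = 0`. -/
def diagY₁ : Diagram where
  U := ℝ
  V := ℝ
  X₁ := 0
  X₂ := 0
  Y₁ := LinearMap.id
  Y₂ := 0
  rel := by simp
  nilp := by simp

/-- `U = V = ℝ`, `Y = 0`, `X = (1, 0)`. -/
def diagX₁ : Diagram where
  U := ℝ
  V := ℝ
  X₁ := LinearMap.id
  X₂ := 0
  Y₁ := 0
  Y₂ := 0
  rel := by simp
  nilp := by simp

/-- `U = ℝ`, `V = ℝ²`, `Y` is the identity matrix, `X = 0`. -/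
def diagY₂ : Diagram where
  U := ℝ
  V := ℝ × ℝ
  X₁ := 0
  X₂ := 0
  Y₁ := LinearMap.fst ℝ ℝ ℝ
  Y₂ := LinearMap.snd ℝ ℝ ℝ
  rel := by simp
  nilp := by simp

/-- `U = ℝ`, `V = ℝ²`, `Y = 0`, `X` is the identity matrix. -/
def diagX₂ : Diagram where
  U := ℝ
  V := ℝ × ℝ
  X₁ := LinearMap.inl ℝ ℝ ℝ
  X₂ := LinearMap.inr ℝ ℝ ℝ
  Y₁ := 0
  Y₂ := 0
  rel := by simp
  nilp := by simp

/-- The list of the six diagrams. -/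
def sixDiagrams : Fin 6 → Diagram := ![diagS, diagT, diagY₁, diagX₁, diagY₂, diagX₂]

/-! ### Notions for `A`-modules -/

/-- An `A`-module is Schurian if its endomorphism algebra is a division algebra: it is non-zero
and every non-zero endomorphism is invertible. -/
def IsSchurian (M : Type*) [AddCommGroup M] [Module A M] : Prop :=
  Nontrivial (Module.End A M) ∧ ∀ g : Module.End A M, g ≠ 0 → IsUnit g

/-- `M` has dimension vector `(u, v)`: the real vector space `eM` (which is of the form `U ⊕ U`)
has dimension `2u`, and `V = fM` has dimension `v`. -/
def HasDimVector (M : Type*) [AddCommGroup M] [Module ℝ M] [Module A M] [IsScalarTower ℝ A M]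
    (u v : ℕ) : Prop :=
  Module.finrank ℝ (LinearMap.range (Algebra.lsmul ℝ ℝ M idemE)) = 2 * u ∧
    Module.finrank ℝ (LinearMap.range (Algebra.lsmul ℝ ℝ M idemF)) = v

end RealGelfand

end

/-!
Multiplication by `t` is an endomorphism of every `A`-module, and by Nakayama's lemma it is not
surjective on a non-zero finite dimensional one; hence `t` kills every Schurian module `M`. On
modules killed by `t`, the homomorphisms are the linear maps that commute with the four generators
`e`, `ȷ = E₂₁ - E₁₂`, `x₁ = E₃₁` and `y₁ = tE₁₃` of the order.

If `N` is Schurian too, and `L : N → M`, `P : M → N` are homomorphisms with `P ∘ L ≠ 0`, then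
`P ∘ L` and `L ∘ P` are both bijective, so `M ≃ N`. For `N` simple it is enough that `L` and `P`
are non-zero. When `N` is one of the six modules, `L` amounts to a choice of one or two vectors
of `M` and `P` to a linear form on `M`. Such data exist:

* if `x₁` and `y₁` both act non-trivially, or both trivially, for a simple module;
* if only `y₁` acts non-trivially, for a module of length three or two according to whether
  a given non-zero vector of `y₁M` lies in `ȷy₁M` or not;
* if only `x₁` acts non-trivially, for a module of length two or three according to whether
  `e m ∈ eK + ȷK` or not, where `K = ker x₁` and `m ∉ K`.
-/

noncomputable section

namespace RealGelfand

/-! ### Generators of the order -/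

/-- The element `ȷ = E₂₁ - E₁₂`, a complex structure on `eM`. -/
def genJ : A := ⟨!![0, -1, 0; 1, 0, 0; 0, 0, 0], by simp [order]⟩

/-- The element `x₁ = E₃₁`. -/
def genX : A := ⟨!![0, 0, 0; 0, 0, 0; 1, 0, 0], by simp [order]⟩

/-- The element `y₁ = tE₁₃`. -/
def genY : A := ⟨!![0, 0, PowerSeries.X; 0, 0, 0; 0, 0, 0], by simp [order]⟩

/-- The embedding of `ℝ⟦t⟧` into the centre of the order, by scalar matrices. -/
def scalarHom : R →+* A :=
  (algebraMap R (Matrix (Fin 3) (Fin 3) R)).codRestrict order fun p => by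
    change _ ∧ _
    simp [Matrix.algebraMap_matrix_apply]

/-- The scalar matrix `t`. -/
def genT : A := scalarHom PowerSeries.X

theorem scalarHom_mul_comm (p : R) (a : A) : scalarHom p * a = a * scalarHom p :=
  Subtype.ext (Algebra.commutes p a.1)

theorem scalarHom_algebraMap (c : ℝ) : scalarHom (algebraMap ℝ R c) = algebraMap ℝ A c :=
  Subtype.ext (IsScalarTower.algebraMap_apply ℝ R (Matrix (Fin 3) (Fin 3) R) c).symm

theorem coe_scalarHom (p : R) : (scalarHom p).1 = !![p, 0, 0; 0, p, 0; 0, 0, p] := by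
  change algebraMap R (Matrix (Fin 3) (Fin 3) R) p = _
  ext1 i j
  fin_cases i <;> fin_cases j <;> simp [Matrix.algebraMap_matrix_apply]

theorem ext_entries {a b : A} (h : ∀ i j, a.1 i j = b.1 i j) : a = b :=
  Subtype.ext (Matrix.ext h)

theorem idemE_add_idemF : idemE + idemF = 1 :=
  ext_entries (by simp [Fin.forall_fin_succ, idemE, idemF])

theorem idemE_mul_idemE : idemE * idemE = idemE :=
  ext_entries (by simp [Fin.forall_fin_succ, idemE])

theorem idemE_mul_genJ : idemE * genJ = genJ :=
  ext_entries (by simp [Fin.forall_fin_succ, idemE, genJ])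

theorem genJ_mul_idemE : genJ * idemE = genJ :=
  ext_entries (by simp [Fin.forall_fin_succ, idemE, genJ])

theorem genJ_mul_genJ : genJ * genJ = -idemE :=
  ext_entries (by simp [Fin.forall_fin_succ, idemE, genJ])

theorem idemE_mul_genX : idemE * genX = 0 :=
  ext_entries (by simp [Fin.forall_fin_succ, idemE, genX])

theorem genX_mul_idemE : genX * idemE = genX :=
  ext_entries (by simp [Fin.forall_fin_succ, idemE, genX])

theorem idemE_mul_genY : idemE * genY = genY :=
  ext_entries (by simp [Fin.forall_fin_succ, idemE, genY])

theorem genY_mul_idemE : genY * idemE = 0 :=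
  ext_entries (by simp [Fin.forall_fin_succ, idemE, genY])

theorem genX_mul_genY : genX * genY = genT * idemF :=
  ext_entries (by simp [Fin.forall_fin_succ, genX, genY, idemF, genT, coe_scalarHom])

theorem genX_mul_genJ_mul_genY : genX * (genJ * genY) = 0 :=
  ext_entries (by simp [Fin.forall_fin_succ, genX, genJ, genY])

theorem genT_eq : genT = genY * genX - genJ * genY * (genX * genJ) + genX * genY :=
  ext_entries (by simp [Fin.forall_fin_succ, genX, genJ, genY, genT, coe_scalarHom])

/-- The matrix whose last row is `r` and whose other entries vanish. -/
def lastRow (r : Fin 3 → R) : A :=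
  scalarHom (r 0) * genX - scalarHom (r 1) * (genX * genJ) + scalarHom (r 2) * idemF

theorem coe_lastRow (r : Fin 3 → R) :
    (lastRow r).1 = !![0, 0, 0; 0, 0, 0; r 0, r 1, r 2] := by
  simp only [lastRow, coe_scalarHom, Subalgebra.coe_add, Subalgebra.coe_sub, Subalgebra.coe_mul]
  ext1 i j
  fin_cases i <;> fin_cases j <;> simp [genX, genJ, idemF]

theorem eq_generators (a : A) : a =
    ev0 (a.1 0 0) • idemE + ev0 (a.1 1 0) • genJ + lastRow (a.1 2)
      + genY * lastRow (fun k => shift (a.1 0 k))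
      + genJ * genY * lastRow (fun k => shift (a.1 1 k)) := by
  obtain ⟨h02, h12, h00, h10⟩ := a.2
  have h01 : ev0 (a.1 0 1) = -ev0 (a.1 1 0) := by rw [h10, neg_neg]
  have eq_of_ev0 : ∀ (p : R) (c : ℝ), ev0 p = c → p = c • (1 : R) + PowerSeries.X * shift p := by
    rintro p _ rfl
    rw [← Algebra.algebraMap_eq_smul_one, add_comm]
    exact eq_shift p
  apply Subtype.ext
  simp only [Subalgebra.coe_add, Subalgebra.coe_smul, Subalgebra.coe_mul, coe_lastRow]
  ext1 i j
  fin_cases i <;> fin_cases j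
  · simpa [genY, genJ, idemE] using eq_of_ev0 (a.1 0 0) _ rfl
  · simpa [genY, genJ, idemE] using eq_of_ev0 _ _ h01
  · simpa [genY, genJ, idemE] using eq_of_ev0 _ _ h02
  · simpa [genY, genJ, idemE] using eq_of_ev0 (a.1 1 0) _ rfl
  · simpa [genY, genJ, idemE] using eq_of_ev0 _ _ h00.symm
  · simpa [genY, genJ, idemE] using eq_of_ev0 _ _ h12
  all_goals simp [genY, genJ, idemE]

theorem adjoin_generators :
    Algebra.adjoin ℝ (Set.range scalarHom ∪ {idemE, genJ, genX, genY}) = ⊤ := by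
  set S := Algebra.adjoin ℝ (Set.range scalarHom ∪ {idemE, genJ, genX, genY})
  have he : idemE ∈ S := Algebra.subset_adjoin (by simp)
  have hj : genJ ∈ S := Algebra.subset_adjoin (by simp)
  have hx : genX ∈ S := Algebra.subset_adjoin (by simp)
  have hy : genY ∈ S := Algebra.subset_adjoin (by simp)
  have hf : idemF ∈ S := by
    rw [← add_sub_cancel_left idemE idemF, idemE_add_idemF]
    exact sub_mem (one_mem S) he
  have hscalar (p : R) : scalarHom p ∈ S := Algebra.subset_adjoin (by simp)
  have hrow (r : Fin 3 → R) : lastRow r ∈ S :=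
    add_mem (sub_mem (mul_mem (hscalar _) hx) (mul_mem (hscalar _) (mul_mem hx hj)))
      (mul_mem (hscalar _) hf)
  refine eq_top_iff.mpr fun a _ => ?_
  rw [eq_generators a]
  exact add_mem (add_mem (add_mem (add_mem (S.smul_mem he _) (S.smul_mem hj _)) (hrow _))
    (mul_mem hy (hrow _))) (mul_mem (mul_mem hj hy) (hrow _))

section Relations

variable {M : Type*} [AddCommGroup M] [Module A M]

theorem idemE_smul_add_idemF_smul (m : M) : idemE • m + idemF • m = m := by
  rw [← add_smul, idemE_add_idemF, one_smul]

@[simp]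
theorem idemE_smul_idemE_smul (m : M) : idemE • idemE • m = idemE • m := by
  rw [smul_smul, idemE_mul_idemE]

@[simp]
theorem idemE_smul_idemF_smul (m : M) : idemE • idemF • m = 0 := by
  have h := congrArg (idemE • ·) (idemE_smul_add_idemF_smul m)
  simpa using h

@[simp]
theorem idemF_smul_idemE_smul (m : M) : idemF • idemE • m = 0 := by
  simpa using idemE_smul_add_idemF_smul (idemE • m)

@[simp]
theorem idemE_smul_genJ_smul (m : M) : idemE • genJ • m = genJ • m := by
  rw [smul_smul, idemE_mul_genJ]

@[simp]
theorem genJ_smul_idemE_smul (m : M) : genJ • idemE • m = genJ • m := by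
  rw [smul_smul, genJ_mul_idemE]

@[simp]
theorem genJ_smul_genJ_smul (m : M) : genJ • genJ • m = -(idemE • m) := by
  rw [smul_smul, genJ_mul_genJ, neg_smul]

@[simp]
theorem idemE_smul_genX_smul (m : M) : idemE • genX • m = 0 := by
  rw [smul_smul, idemE_mul_genX, zero_smul]

@[simp]
theorem genX_smul_idemE_smul (m : M) : genX • idemE • m = genX • m := by
  rw [smul_smul, genX_mul_idemE]

@[simp]
theorem idemE_smul_genY_smul (m : M) : idemE • genY • m = genY • m := by
  rw [smul_smul, idemE_mul_genY]

@[simp]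
theorem genY_smul_idemE_smul (m : M) : genY • idemE • m = 0 := by
  rw [smul_smul, genY_mul_idemE, zero_smul]

@[simp]
theorem genX_smul_genJ_smul_genY_smul (m : M) : genX • genJ • genY • m = 0 := by
  rw [smul_smul, smul_smul, mul_assoc, genX_mul_genJ_mul_genY, zero_smul]

theorem genJ_smul_of_idemE_smul_eq_zero {v : M} (hv : idemE • v = 0) : genJ • v = 0 := by
  rw [← genJ_smul_idemE_smul, hv, smul_zero]

theorem genX_smul_of_idemE_smul_eq_zero {v : M} (hv : idemE • v = 0) : genX • v = 0 := by
  rw [← genX_smul_idemE_smul, hv, smul_zero]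

theorem genY_smul_of_idemE_smul_eq_self {w : M} (hw : idemE • w = w) : genY • w = 0 := by
  rw [← hw, genY_smul_idemE_smul]

@[simp]
theorem genJ_smul_genX_smul (m : M) : genJ • genX • m = 0 :=
  genJ_smul_of_idemE_smul_eq_zero (idemE_smul_genX_smul m)

@[simp]
theorem genY_smul_genJ_smul (m : M) : genY • genJ • m = 0 :=
  genY_smul_of_idemE_smul_eq_self (idemE_smul_genJ_smul m)

@[simp]
theorem genY_smul_idemF_smul (m : M) : genY • idemF • m = genY • m := by
  simpa using congrArg (genY • ·) (idemE_smul_add_idemF_smul m)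

@[simp]
theorem idemF_smul_genX_smul (m : M) : idemF • genX • m = genX • m := by
  simpa using idemE_smul_add_idemF_smul (genX • m)

theorem genX_smul_genY_smul (hM : Module.IsTorsionBy A M genT) (m : M) :
    genX • genY • m = 0 := by
  rw [smul_smul, genX_mul_genY, mul_smul, hM]

variable [Module ℝ M] [IsScalarTower ℝ A M]

theorem order_smul_real_smul (a : A) (c : ℝ) (m : M) : a • c • m = c • a • m :=
  (smul_comm c a m).symm

theorem scalarHom_smul (hM : Module.IsTorsionBy A M genT) (p : R) (m : M) :
    scalarHom p • m = ev0 p • m := by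
  have h : scalarHom p = scalarHom (shift p) * genT + algebraMap ℝ A (ev0 p) := by
    conv_lhs => rw [eq_shift p, map_add, map_mul, scalarHom_mul_comm, scalarHom_algebraMap, ← genT]
  rw [h, add_smul, mul_smul, hM, smul_zero, zero_add, algebraMap_smul]

variable {N : Type*} [AddCommGroup N] [Module ℝ N] [Module A N] [IsScalarTower ℝ A N]

/-- On modules killed by `t`, a linear map which commutes with the generators `e`, `ȷ`, `x₁`, `y₁`
is a homomorphism. -/
def homOfGenerators (hM : Module.IsTorsionBy A M genT) (hN : Module.IsTorsionBy A N genT)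
    (g : M →ₗ[ℝ] N) (he : ∀ m, g (idemE • m) = idemE • g m)
    (hj : ∀ m, g (genJ • m) = genJ • g m) (hx : ∀ m, g (genX • m) = genX • g m)
    (hy : ∀ m, g (genY • m) = genY • g m) : M →ₗ[A] N where
  toFun := g
  map_add' := map_add g
  map_smul' a := by
    have ha : a ∈ Algebra.adjoin ℝ (Set.range scalarHom ∪ {idemE, genJ, genX, genY}) := by
      simp only [adjoin_generators, Algebra.mem_top]
    change ∀ m, g (a • m) = a • g m
    induction ha using Algebra.adjoin_induction with
    | mem a ha =>
      rcases ha with ⟨p, rfl⟩ | rfl | rfl | rfl | rfl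
      · intro m
        rw [scalarHom_smul hM, scalarHom_smul hN, map_smul]
      exacts [he, hj, hx, hy]
    | algebraMap c => intro m; rw [algebraMap_smul, algebraMap_smul, map_smul]
    | add a b _ _ ha hb => intro m; rw [add_smul, map_add, ha, hb, add_smul]
    | mul a b _ _ ha hb => intro m; rw [mul_smul, ha, hb, mul_smul]

end Relations

/-! ### Modules given by diagrams -/

theorem shift_one : shift 1 = 0 := shift_unique (c := 1) (by simp)

theorem shift_X : shift PowerSeries.X = 1 := shift_unique (c := 0) (by simp)

namespace Diagram

variable (D : Diagram)

/-- The element of the module `(U ⊕ U) ⊕ V` with the given components. -/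
def pair (w : D.U × D.U) (v : D.V) : D.Mod := (w, v)

/-- The inclusion of `U` into the module `U ⊕ U ⊕ V` as the first summand; the second summand
is the image of the first one under `ȷ`. -/
def inU : D.U →ₗ[ℝ] D.Mod := LinearMap.inl ℝ (D.U × D.U) D.V ∘ₗ LinearMap.inl ℝ D.U D.U

/-- The inclusion of `V` into the module `U ⊕ U ⊕ V`. -/
def inV : D.V →ₗ[ℝ] D.Mod := LinearMap.inr ℝ (D.U × D.U) D.V

/-- The projection of the module `U ⊕ U ⊕ V` onto its first summand. -/
def fstU : D.Mod →ₗ[ℝ] D.U := LinearMap.fst ℝ D.U D.U ∘ₗ LinearMap.fst ℝ (D.U × D.U) D.V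

/-- The projection of the module `U ⊕ U ⊕ V` onto its second summand. -/
def sndU : D.Mod →ₗ[ℝ] D.U := LinearMap.snd ℝ D.U D.U ∘ₗ LinearMap.fst ℝ (D.U × D.U) D.V

/-- The projection of the module `U ⊕ U ⊕ V` onto its last summand. -/
def projV : D.Mod →ₗ[ℝ] D.V := LinearMap.snd ℝ (D.U × D.U) D.V

theorem smul_pair (a : A) (w : D.U × D.U) (v : D.V) :
    a • D.pair w v = D.pair (D.actW a (w, v)) (D.actV a (w, v)) := rfl

theorem idemE_smul_pair (w : D.U × D.U) (v : D.V) : idemE • D.pair w v = D.pair w 0 := by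
  rw [smul_pair]
  congr 1 <;> simp [actW, actV, idemE, Fin.sum_univ_two, shift_one]

theorem idemF_smul_pair (w : D.U × D.U) (v : D.V) : idemF • D.pair w v = D.pair 0 v := by
  rw [smul_pair]
  congr 1 <;> simp [actW, actV, idemF, Fin.sum_univ_two]

theorem genJ_smul_pair (w : D.U × D.U) (v : D.V) : genJ • D.pair w v = D.pair (D.J w) 0 := by
  rw [smul_pair]
  congr 1 <;> simp [actW, actV, genJ, Fin.sum_univ_two, shift_one]

theorem genX_smul_pair (w : D.U × D.U) (v : D.V) : genX • D.pair w v = D.pair 0 (D.X w) := by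
  rw [smul_pair]
  congr 1 <;> simp [actW, actV, genX, x, Fin.sum_univ_two]

theorem genY_smul_pair (w : D.U × D.U) (v : D.V) : genY • D.pair w v = D.pair (D.Y v) 0 := by
  rw [smul_pair]
  congr 1 <;> simp [actW, actV, genY, y, Fin.sum_univ_two, shift_X]

variable {D}

theorem genJ_smul_inU (u : D.U) : genJ • D.inU u = D.pair (0, u) 0 :=
  (D.genJ_smul_pair (u, 0) 0).trans (by simp [J])

@[simp]
theorem idemE_smul_inU (u : D.U) : idemE • D.inU u = D.inU u := D.idemE_smul_pair (u, 0) 0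

@[simp]
theorem idemE_smul_inV (v : D.V) : idemE • D.inV v = 0 := D.idemE_smul_pair 0 v

@[simp]
theorem genX_smul_inU (u : D.U) : genX • D.inU u = D.inV (D.X₁ u) :=
  (D.genX_smul_pair (u, 0) 0).trans (congrArg (D.pair 0) (by simp [X]))

@[simp]
theorem genX_smul_genJ_smul_inU (u : D.U) : genX • genJ • D.inU u = D.inV (D.X₂ u) := by
  rw [genJ_smul_inU, genX_smul_pair]
  exact congrArg (D.pair 0) (by simp [X])

theorem pair_eq (u₁ u₂ : D.U) (v : D.V) :
    D.pair (u₁, u₂) v = D.inU u₁ + genJ • D.inU u₂ + D.inV v := by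
  rw [genJ_smul_inU]
  exact Prod.ext (Prod.ext (show u₁ = u₁ + 0 + 0 by simp) (show u₂ = 0 + u₂ + 0 by simp))
    (show v = 0 + 0 + v by simp)

theorem exists_eq (m : D.Mod) : ∃ u₁ u₂ v, m = D.inU u₁ + genJ • D.inU u₂ + D.inV v :=
  ⟨m.1.1, m.1.2, m.2, pair_eq _ _ _⟩

@[simp]
theorem genY_smul_inV (v : D.V) : genY • D.inV v = D.inU (D.Y₁ v) + genJ • D.inU (D.Y₂ v) := by
  have h : genY • D.inV v = D.pair (D.Y₁ v, D.Y₂ v) 0 := D.genY_smul_pair 0 v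
  rw [h, pair_eq, map_zero, add_zero]

@[simp]
theorem genJ_smul_inV (v : D.V) : genJ • D.inV v = 0 :=
  genJ_smul_of_idemE_smul_eq_zero (idemE_smul_inV v)

@[simp]
theorem genX_smul_inV (v : D.V) : genX • D.inV v = 0 :=
  genX_smul_of_idemE_smul_eq_zero (idemE_smul_inV v)

@[simp]
theorem genY_smul_inU (u : D.U) : genY • D.inU u = 0 :=
  genY_smul_of_idemE_smul_eq_self (idemE_smul_inU u)

@[simp]
theorem fstU_inU (u : D.U) : D.fstU (D.inU u) = u := rfl

@[simp]
theorem sndU_inU (u : D.U) : D.sndU (D.inU u) = 0 := rfl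

@[simp]
theorem projV_inU (u : D.U) : D.projV (D.inU u) = 0 := rfl

@[simp]
theorem fstU_genJ_smul_inU (u : D.U) : D.fstU (genJ • D.inU u) = 0 := by
  rw [genJ_smul_inU]; rfl

@[simp]
theorem sndU_genJ_smul_inU (u : D.U) : D.sndU (genJ • D.inU u) = u := by
  rw [genJ_smul_inU]; rfl

@[simp]
theorem projV_genJ_smul_inU (u : D.U) : D.projV (genJ • D.inU u) = 0 := by
  rw [genJ_smul_inU]; rfl

@[simp]
theorem fstU_inV (v : D.V) : D.fstU (D.inV v) = 0 := rfl

@[simp]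
theorem sndU_inV (v : D.V) : D.sndU (D.inV v) = 0 := rfl

@[simp]
theorem projV_inV (v : D.V) : D.projV (D.inV v) = v := rfl

theorem inV_injective : Function.Injective D.inV := LinearMap.inr_injective

theorem exists_inV_of_idemE_smul_eq_zero {m : D.Mod} (hm : idemE • m = 0) : ∃ v, m = D.inV v := by
  obtain ⟨u₁, u₂, v, rfl⟩ := exists_eq m
  exact ⟨v, by simpa using hm⟩

theorem exists_inU_of_idemE_smul_eq_self {m : D.Mod} (hm : idemE • m = m) :
    ∃ u₁ u₂, m = D.inU u₁ + genJ • D.inU u₂ := by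
  obtain ⟨u₁, u₂, v, rfl⟩ := exists_eq m
  exact ⟨u₁, u₂, by simpa using hm.symm⟩

theorem isTorsionBy_of_X_eq_zero (h₁ : D.X₁ = 0) (h₂ : D.X₂ = 0) :
    Module.IsTorsionBy A D.Mod genT := fun m => by
  obtain ⟨u₁, u₂, v, rfl⟩ := exists_eq m
  simp [genT_eq, add_smul, sub_smul, mul_smul, h₁, h₂]

theorem isTorsionBy_of_Y_eq_zero (h₁ : D.Y₁ = 0) (h₂ : D.Y₂ = 0) :
    Module.IsTorsionBy A D.Mod genT := fun m => by
  obtain ⟨u₁, u₂, v, rfl⟩ := exists_eq m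
  simp [genT_eq, add_smul, sub_smul, mul_smul, h₁, h₂]

section Hom

variable {M : Type*} [AddCommGroup M] [Module ℝ M] [Module A M] [IsScalarTower ℝ A M]

/-- The homomorphism out of the module of a diagram that extends linear maps on `U` and on `V`. -/
def lift (hD : Module.IsTorsionBy A D.Mod genT) (hM : Module.IsTorsionBy A M genT)
    (φ : D.U →ₗ[ℝ] M) (ψ : D.V →ₗ[ℝ] M)
    (hφ : ∀ u, idemE • φ u = φ u) (hψ : ∀ v, idemE • ψ v = 0)
    (hX₁ : ∀ u, genX • φ u = ψ (D.X₁ u)) (hX₂ : ∀ u, genX • genJ • φ u = ψ (D.X₂ u))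
    (hY : ∀ v, genY • ψ v = φ (D.Y₁ v) + genJ • φ (D.Y₂ v)) : D.Mod →ₗ[A] M :=
  have hj (v) : genJ • ψ v = 0 := genJ_smul_of_idemE_smul_eq_zero (hψ v)
  have hx (v) : genX • ψ v = 0 := genX_smul_of_idemE_smul_eq_zero (hψ v)
  have hy (u) : genY • φ u = 0 := genY_smul_of_idemE_smul_eq_self (hφ u)
  homOfGenerators hD hM
    (φ ∘ₗ D.fstU + Algebra.lsmul ℝ ℝ M genJ ∘ₗ φ ∘ₗ D.sndU + ψ ∘ₗ D.projV)
    (fun m => by obtain ⟨u₁, u₂, v, rfl⟩ := exists_eq m; simp [hφ, hψ])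
    (fun m => by obtain ⟨u₁, u₂, v, rfl⟩ := exists_eq m; simp [hφ, hj, add_comm])
    (fun m => by obtain ⟨u₁, u₂, v, rfl⟩ := exists_eq m; simp [hX₁, hX₂, hx])
    (fun m => by obtain ⟨u₁, u₂, v, rfl⟩ := exists_eq m; simp [hY, hy])

/-- The homomorphism to the module of a diagram with components `l ∘ e` and `-l ∘ ȷ` in `U` and
`k` in `V`; every homomorphism to this module is of this form. -/
def colift (hM : Module.IsTorsionBy A M genT) (hD : Module.IsTorsionBy A D.Mod genT)
    (l : M →ₗ[ℝ] D.U) (k : M →ₗ[ℝ] D.V) (hk : ∀ m, k (idemE • m) = 0)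
    (hX : ∀ m, k (genX • m) = D.X₁ (l (idemE • m)) - D.X₂ (l (genJ • m)))
    (hY₁ : ∀ m, l (genY • m) = D.Y₁ (k m)) (hY₂ : ∀ m, -l (genJ • genY • m) = D.Y₂ (k m)) :
    M →ₗ[A] D.Mod :=
  have hj (m : M) : k (genJ • m) = 0 := by rw [← idemE_smul_genJ_smul, hk]
  have hy (m : M) : k (genY • m) = 0 := by rw [← idemE_smul_genY_smul, hk]
  homOfGenerators hM hD
    (D.inU ∘ₗ l ∘ₗ Algebra.lsmul ℝ ℝ M idemE
      - Algebra.lsmul ℝ ℝ D.Mod genJ ∘ₗ D.inU ∘ₗ l ∘ₗ Algebra.lsmul ℝ ℝ M genJ + D.inV ∘ₗ k)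
    (fun m => by simp [hk, smul_sub])
    (fun m => by simp [hj, smul_sub, add_comm])
    (fun m => by simp [hX, smul_sub])
    (fun m => by simp [hy, hY₁, ← hY₂, sub_eq_add_neg])

@[simp]
theorem lift_inU (hD : Module.IsTorsionBy A D.Mod genT) (hM : Module.IsTorsionBy A M genT)
    (φ : D.U →ₗ[ℝ] M) (ψ : D.V →ₗ[ℝ] M) (hφ hψ hX₁ hX₂ hY) (u : D.U) :
    lift hD hM φ ψ hφ hψ hX₁ hX₂ hY (D.inU u) = φ u := by
  simp [lift, homOfGenerators]

@[simp]
theorem lift_inV (hD : Module.IsTorsionBy A D.Mod genT) (hM : Module.IsTorsionBy A M genT)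
    (φ : D.U →ₗ[ℝ] M) (ψ : D.V →ₗ[ℝ] M) (hφ hψ hX₁ hX₂ hY) (v : D.V) :
    lift hD hM φ ψ hφ hψ hX₁ hX₂ hY (D.inV v) = ψ v := by
  simp [lift, homOfGenerators]

theorem fstU_colift (hM : Module.IsTorsionBy A M genT) (hD : Module.IsTorsionBy A D.Mod genT)
    (l : M →ₗ[ℝ] D.U) (k : M →ₗ[ℝ] D.V) (hk hX hY₁ hY₂) (m : M) :
    D.fstU (colift hM hD l k hk hX hY₁ hY₂ m) = l (idemE • m) := by
  simp [colift, homOfGenerators]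

theorem projV_colift (hM : Module.IsTorsionBy A M genT) (hD : Module.IsTorsionBy A D.Mod genT)
    (l : M →ₗ[ℝ] D.U) (k : M →ₗ[ℝ] D.V) (hk hX hY₁ hY₂) (m : M) :
    D.projV (colift hM hD l k hk hX hY₁ hY₂ m) = k m := by
  simp [colift, homOfGenerators]

end Hom

section Ext

variable {M : Type*} [AddCommGroup M] [Module A M]

theorem hom_ext {g h : D.Mod →ₗ[A] M} (hU : ∀ u, g (D.inU u) = h (D.inU u))
    (hV : ∀ v, g (D.inV v) = h (D.inV v)) : g = h := LinearMap.ext fun m => by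
  obtain ⟨u₁, u₂, v, rfl⟩ := exists_eq m
  simp [hU, hV]

theorem inV_X (w : D.U × D.U) :
    D.inV (D.X w) = genX • D.inU w.1 + genX • genJ • D.inU w.2 := by
  simp [X]

theorem hom_ext_of_surjective_X (hX : Function.Surjective D.X) {g h : D.Mod →ₗ[A] M}
    (hU : ∀ u, g (D.inU u) = h (D.inU u)) : g = h := hom_ext hU fun v => by
  obtain ⟨w, rfl⟩ := hX v
  simp only [inV_X, map_add, map_smul, hU]

variable {D' : Diagram}

theorem exists_map_inU (g : D.Mod →ₗ[A] D'.Mod) (u : D.U) :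
    ∃ u₁ u₂, g (D.inU u) = D'.inU u₁ + genJ • D'.inU u₂ :=
  exists_inU_of_idemE_smul_eq_self (by rw [← map_smul, idemE_smul_inU])

theorem exists_map_inV (g : D.Mod →ₗ[A] D'.Mod) (v : D.V) : ∃ v', g (D.inV v) = D'.inV v' :=
  exists_inV_of_idemE_smul_eq_zero (by rw [← map_smul, idemE_smul_inV, map_zero])

theorem hom_ext_of_injective_Y (hY : Function.Injective D'.Y) {g h : D.Mod →ₗ[A] D'.Mod}
    (hU : ∀ u, g (D.inU u) = h (D.inU u)) : g = h := hom_ext hU fun v => by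
  obtain ⟨a, ha⟩ := exists_map_inV g v
  obtain ⟨b, hb⟩ := exists_map_inV h v
  have hab : genY • D'.inV a = genY • D'.inV b := by
    rw [← ha, ← hb, ← map_smul g, ← map_smul h, genY_smul_inV]
    simp only [map_add, map_smul, hU]
  have hfst : D'.Y₁ a = D'.Y₁ b := by simpa using congrArg D'.fstU hab
  have hsnd : D'.Y₂ a = D'.Y₂ b := by simpa using congrArg D'.sndU hab
  rw [ha, hb, hY (Prod.ext hfst hsnd)]

end Ext

theorem hasDimVector : HasDimVector D.Mod (Module.finrank ℝ D.U) (Module.finrank ℝ D.V) := by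
  have he : LinearMap.range (Algebra.lsmul ℝ ℝ D.Mod idemE)
      = LinearMap.range (LinearMap.inl ℝ (D.U × D.U) D.V) :=
    Submodule.ext fun m => ⟨fun ⟨n, hn⟩ => ⟨n.1, (D.idemE_smul_pair n.1 n.2).symm.trans hn⟩,
      fun ⟨w, hw⟩ => ⟨m, (D.idemE_smul_pair m.1 m.2).trans (hw ▸ rfl)⟩⟩
  have hf : LinearMap.range (Algebra.lsmul ℝ ℝ D.Mod idemF) = LinearMap.range D.inV :=
    Submodule.ext fun m => ⟨fun ⟨n, hn⟩ => ⟨n.2, (D.idemF_smul_pair n.1 n.2).symm.trans hn⟩,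
      fun ⟨v, hv⟩ => ⟨m, (D.idemF_smul_pair m.1 m.2).trans (hv ▸ rfl)⟩⟩
  constructor
  · rw [he]
    refine (LinearMap.finrank_range_of_inj LinearMap.inl_injective).trans ?_
    rw [Module.finrank_prod, two_mul]
  · rw [hf]
    exact LinearMap.finrank_range_of_inj inV_injective

theorem finrank_mod :
    Module.finrank ℝ D.Mod = 2 * Module.finrank ℝ D.U + Module.finrank ℝ D.V := by
  change Module.finrank ℝ ((D.U × D.U) × D.V) = _
  rw [Module.finrank_prod, Module.finrank_prod, two_mul]

end Diagram

/-! ### Lengths -/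

theorem exact_prodMap {P Q N P' Q' N' : Type*} [Zero N] [Zero N'] {f : P → Q} {g : Q → N}
    {f' : P' → Q'} {g' : Q' → N'} (h : Function.Exact f g) (h' : Function.Exact f' g') :
    Function.Exact (Prod.map f f') (Prod.map g g') := fun q => by
  rw [Set.range_prodMap, Set.mem_prod, ← h, ← h', Prod.ext_iff]
  rfl

namespace Diagram

variable {D D' D'' : Diagram}

variable (D D') in
/-- A morphism of diagrams: linear maps on `U` and on `V` which commute with `X` and `Y`. -/
structure Hom where
  onU : D.U →ₗ[ℝ] D'.U
  onV : D.V →ₗ[ℝ] D'.V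
  X₁_onU : ∀ u, D'.X₁ (onU u) = onV (D.X₁ u)
  X₂_onU : ∀ u, D'.X₂ (onU u) = onV (D.X₂ u)
  Y₁_onV : ∀ v, D'.Y₁ (onV v) = onU (D.Y₁ v)
  Y₂_onV : ∀ v, D'.Y₂ (onV v) = onU (D.Y₂ v)

/-- The homomorphism of modules induced by a morphism of diagrams. -/
def Hom.map (hD : Module.IsTorsionBy A D.Mod genT) (hD' : Module.IsTorsionBy A D'.Mod genT)
    (f : D.Hom D') : D.Mod →ₗ[A] D'.Mod :=
  lift hD hD' (D'.inU ∘ₗ f.onU) (D'.inV ∘ₗ f.onV) (by simp) (by simp)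
    (by simp [f.X₁_onU]) (by simp [f.X₂_onU]) (by simp [f.Y₁_onV, f.Y₂_onV])

theorem Hom.map_pair (hD : Module.IsTorsionBy A D.Mod genT)
    (hD' : Module.IsTorsionBy A D'.Mod genT) (f : D.Hom D') (w : D.U × D.U) (v : D.V) :
    f.map hD hD' (D.pair w v) = D'.pair (f.onU w.1, f.onU w.2) (f.onV v) := by
  rw [← Prod.mk.eta (p := w), pair_eq, pair_eq]
  simp [map]

theorem Hom.coe_map (hD : Module.IsTorsionBy A D.Mod genT)
    (hD' : Module.IsTorsionBy A D'.Mod genT) (f : D.Hom D') :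
    ⇑(f.map hD hD') = Prod.map (Prod.map f.onU f.onU) f.onV :=
  funext fun m => f.map_pair hD hD' m.1 m.2

theorem length_eq_add_of_exact (hD : Module.IsTorsionBy A D.Mod genT)
    (hD' : Module.IsTorsionBy A D'.Mod genT) (hD'' : Module.IsTorsionBy A D''.Mod genT)
    (f : D.Hom D') (g : D'.Hom D'')
    (hfU : Function.Injective f.onU) (hgU : Function.Surjective g.onU)
    (hU : Function.Exact f.onU g.onU)
    (hfV : Function.Injective f.onV) (hgV : Function.Surjective g.onV)
    (hV : Function.Exact f.onV g.onV) :
    Module.length A D'.Mod = Module.length A D.Mod + Module.length A D''.Mod := by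
  refine Module.length_eq_add_of_exact (f.map hD hD') (g.map hD' hD'') ?_ ?_ ?_
  · rw [Hom.coe_map]
    exact (hfU.prodMap hfU).prodMap hfV
  · rw [Hom.coe_map]
    exact (hgU.prodMap hgU).prodMap hgV
  · rw [Hom.coe_map, Hom.coe_map]
    exact exact_prodMap (exact_prodMap hU hU) hV

theorem isSimpleModule_of_finrank_U [Subsingleton D.V] (hU : Module.finrank ℝ D.U = 1) :
    IsSimpleModule A D.Mod := by
  obtain ⟨u₀, hu₀, hspan⟩ := finrank_eq_one_iff'.mp hU
  have exists_complex (m : D.Mod) :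
      ∃ z : ℂ, m = z.re • D.inU u₀ + z.im • genJ • D.inU u₀ := by
    obtain ⟨u₁, u₂, v, rfl⟩ := exists_eq m
    obtain ⟨p, rfl⟩ := hspan u₁
    obtain ⟨q, rfl⟩ := hspan u₂
    refine ⟨⟨p, q⟩, ?_⟩
    rw [Subsingleton.elim v 0, map_smul, map_smul, order_smul_real_smul, map_zero, add_zero]
  refine isSimpleModule_iff_toSpanSingleton_surjective.mpr
    ⟨⟨D.inU u₀, 0, fun h => hu₀ (by simpa using congrArg D.fstU h)⟩, fun m hm n => ?_⟩
  obtain ⟨z, rfl⟩ := exists_complex m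
  obtain ⟨z', rfl⟩ := exists_complex n
  have hz : z ≠ 0 := by rintro rfl; simp at hm
  have hdiv : z' / z * z = z' := div_mul_cancel₀ z' hz
  refine ⟨(z' / z).re • idemE + (z' / z).im • genJ, ?_⟩
  conv_rhs => rw [← hdiv, Complex.mul_re, Complex.mul_im]
  simp only [LinearMap.toSpanSingleton_apply, add_smul, smul_assoc, smul_add, order_smul_real_smul,
    idemE_smul_inU, idemE_smul_genJ_smul, genJ_smul_genJ_smul]
  generalize genJ • D.inU u₀ = w
  module

theorem isSimpleModule_of_finrank_V [Subsingleton D.U] (hV : Module.finrank ℝ D.V = 1) :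
    IsSimpleModule A D.Mod := by
  have hD : Module.finrank ℝ D.Mod = 1 := by
    rw [finrank_mod, hV, Module.finrank_zero_of_subsingleton]
  have : Nontrivial D.Mod := Module.nontrivial_of_finrank_pos (R := ℝ) (by rw [hD]; norm_num)
  refine isSimpleModule_iff_toSpanSingleton_surjective.mpr ⟨inferInstance, fun m hm n => ?_⟩
  obtain ⟨c, rfl⟩ := exists_smul_eq_of_finrank_eq_one hD hm n
  exact ⟨algebraMap ℝ A c, algebraMap_smul A c m⟩

end Diagram

instance : Subsingleton diagS.V := inferInstanceAs (Subsingleton PUnit)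

instance : Subsingleton diagT.U := inferInstanceAs (Subsingleton PUnit)

theorem isTorsionBy_diagS : Module.IsTorsionBy A diagS.Mod genT :=
  Diagram.isTorsionBy_of_X_eq_zero rfl rfl

theorem isTorsionBy_diagT : Module.IsTorsionBy A diagT.Mod genT :=
  Diagram.isTorsionBy_of_X_eq_zero rfl rfl

theorem isTorsionBy_diagY₁ : Module.IsTorsionBy A diagY₁.Mod genT :=
  Diagram.isTorsionBy_of_X_eq_zero rfl rfl

theorem isTorsionBy_diagX₁ : Module.IsTorsionBy A diagX₁.Mod genT :=
  Diagram.isTorsionBy_of_Y_eq_zero rfl rfl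

theorem isTorsionBy_diagY₂ : Module.IsTorsionBy A diagY₂.Mod genT :=
  Diagram.isTorsionBy_of_X_eq_zero rfl rfl

theorem isTorsionBy_diagX₂ : Module.IsTorsionBy A diagX₂.Mod genT :=
  Diagram.isTorsionBy_of_Y_eq_zero rfl rfl

instance isSimpleModule_diagS : IsSimpleModule A diagS.Mod :=
  Diagram.isSimpleModule_of_finrank_U (Module.finrank_self ℝ)

instance isSimpleModule_diagT : IsSimpleModule A diagT.Mod :=
  Diagram.isSimpleModule_of_finrank_V (Module.finrank_self ℝ)

theorem hasDimVector_diagS : HasDimVector diagS.Mod 1 0 := by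
  simpa only [Module.finrank_zero_of_subsingleton, show Module.finrank ℝ diagS.U = 1 from
    Module.finrank_self ℝ] using diagS.hasDimVector

theorem hasDimVector_diagT : HasDimVector diagT.Mod 0 1 := by
  simpa only [Module.finrank_zero_of_subsingleton, show Module.finrank ℝ diagT.V = 1 from
    Module.finrank_self ℝ] using diagT.hasDimVector

theorem length_diagY₁ : Module.length A diagY₁.Mod = 2 := by
  let f : diagS.Hom diagY₁ :=
    ⟨LinearMap.id, 0, fun _ => rfl, fun _ => rfl, fun _ => rfl, fun _ => rfl⟩
  let g : diagY₁.Hom diagT :=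
    ⟨0, LinearMap.id, fun _ => rfl, fun _ => rfl, fun _ => rfl, fun _ => rfl⟩
  rw [Diagram.length_eq_add_of_exact isTorsionBy_diagS isTorsionBy_diagY₁ isTorsionBy_diagT f g
      Function.injective_id (Function.surjective_to_subsingleton _)
      ((LinearMap.exact_zero_iff_surjective _ f.onU).mpr Function.surjective_id)
      (Function.injective_of_subsingleton _) Function.surjective_id
      ((LinearMap.exact_zero_iff_injective _ g.onV).mpr Function.injective_id),
    Module.length_eq_one A diagS.Mod, Module.length_eq_one A diagT.Mod, one_add_one_eq_two]

theorem length_diagX₁ : Module.length A diagX₁.Mod = 2 := by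
  let f : diagT.Hom diagX₁ :=
    ⟨0, LinearMap.id, fun _ => rfl, fun _ => rfl, fun _ => rfl, fun _ => rfl⟩
  let g : diagX₁.Hom diagS :=
    ⟨LinearMap.id, 0, fun _ => rfl, fun _ => rfl, fun _ => rfl, fun _ => rfl⟩
  rw [Diagram.length_eq_add_of_exact isTorsionBy_diagT isTorsionBy_diagX₁ isTorsionBy_diagS f g
      (Function.injective_of_subsingleton _) Function.surjective_id
      ((LinearMap.exact_zero_iff_injective _ g.onU).mpr Function.injective_id)
      Function.injective_id (Function.surjective_to_subsingleton _)
      ((LinearMap.exact_zero_iff_surjective _ f.onV).mpr Function.surjective_id),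
    Module.length_eq_one A diagS.Mod, Module.length_eq_one A diagT.Mod, one_add_one_eq_two]

theorem length_diagY₂ : Module.length A diagY₂.Mod = 3 := by
  let f : diagY₁.Hom diagY₂ :=
    ⟨LinearMap.id, LinearMap.inl ℝ ℝ ℝ, fun _ => rfl, fun _ => rfl, fun _ => rfl, fun _ => rfl⟩
  let g : diagY₂.Hom diagT :=
    ⟨0, LinearMap.snd ℝ ℝ ℝ, fun _ => rfl, fun _ => rfl, fun _ => rfl, fun _ => rfl⟩
  rw [Diagram.length_eq_add_of_exact isTorsionBy_diagY₁ isTorsionBy_diagY₂ isTorsionBy_diagT f g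
      Function.injective_id (Function.surjective_to_subsingleton _)
      ((LinearMap.exact_zero_iff_surjective _ f.onU).mpr Function.surjective_id)
      (LinearMap.inl_injective (R := ℝ) (M := ℝ) (M₂ := ℝ))
      (LinearMap.snd_surjective (R := ℝ) (M := ℝ) (M₂ := ℝ))
      (Function.Exact.inl_snd (R := ℝ) (M := ℝ) (N := ℝ)),
    length_diagY₁, Module.length_eq_one A diagT.Mod, two_add_one_eq_three]

theorem length_diagX₂ : Module.length A diagX₂.Mod = 3 := by
  let f : diagT.Hom diagX₂ :=
    ⟨0, LinearMap.inr ℝ ℝ ℝ, fun _ => rfl, fun _ => rfl, fun _ => rfl, fun _ => rfl⟩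
  let g : diagX₂.Hom diagX₁ :=
    ⟨LinearMap.id, LinearMap.fst ℝ ℝ ℝ, fun _ => rfl, fun _ => rfl, fun _ => rfl, fun _ => rfl⟩
  rw [Diagram.length_eq_add_of_exact isTorsionBy_diagT isTorsionBy_diagX₂ isTorsionBy_diagX₁ f g
      (Function.injective_of_subsingleton _) Function.surjective_id
      ((LinearMap.exact_zero_iff_injective _ g.onU).mpr Function.injective_id)
      (LinearMap.inr_injective (R := ℝ) (M := ℝ) (M₂ := ℝ))
      (LinearMap.fst_surjective (R := ℝ) (M := ℝ) (M₂ := ℝ))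
      (Function.Exact.inr_fst (R := ℝ) (M := ℝ) (N := ℝ)),
    length_diagX₁, Module.length_eq_one A diagT.Mod, add_comm, two_add_one_eq_three]

/-! ### Endomorphism algebras -/

theorem nonempty_algEquiv_real {B : Type*} [Ring B] [Algebra ℝ B] [Nontrivial B]
    (h : ∀ g : B, ∃ a : ℝ, g = a • 1) : Nonempty (B ≃ₐ[ℝ] ℝ) := by
  refine ⟨(AlgEquiv.ofBijective (Algebra.ofId ℝ B) ⟨RingHom.injective _, fun g => ?_⟩).symm⟩
  obtain ⟨a, rfl⟩ := h g
  exact ⟨a, Algebra.algebraMap_eq_smul_one a⟩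

theorem nonempty_algEquiv_complex {B : Type*} [Ring B] [Algebra ℝ B] [Nontrivial B] {i : B}
    (hi : i * i = -1) (h : ∀ g : B, ∃ a b : ℝ, g = a • 1 + b • i) : Nonempty (B ≃ₐ[ℝ] ℂ) := by
  refine ⟨(AlgEquiv.ofBijective (Complex.liftAux i hi) ⟨RingHom.injective _, fun g => ?_⟩).symm⟩
  obtain ⟨a, b, rfl⟩ := h g
  exact ⟨⟨a, b⟩, by rw [Complex.liftAux_apply, Algebra.algebraMap_eq_smul_one]⟩

namespace Diagram

variable {D : Diagram}

instance [Nontrivial D.U] : Nontrivial D.Mod :=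
  Function.Injective.nontrivial (f := D.inU) (Function.LeftInverse.injective fstU_inU)

theorem exists_forall_map_inU (hU : Module.finrank ℝ D.U = 1) (g : Module.End A D.Mod) :
    ∃ p q : ℝ, ∀ u, g (D.inU u) = p • D.inU u + q • genJ • D.inU u := by
  obtain ⟨u₀, -, hspan⟩ := finrank_eq_one_iff'.mp hU
  obtain ⟨u₁, u₂, h⟩ := exists_map_inU g u₀
  obtain ⟨p, rfl⟩ := hspan u₁
  obtain ⟨q, rfl⟩ := hspan u₂
  refine ⟨p, q, fun u => ?_⟩
  obtain ⟨c, rfl⟩ := hspan u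
  simp only [map_smul, LinearMap.map_smul_of_tower, h, smul_add, order_smul_real_smul,
    smul_comm c p, smul_comm c q]

theorem nonempty_end_algEquiv_real (hU : Module.finrank ℝ D.U = 1)
    (hext : ∀ {g h : Module.End A D.Mod}, (∀ u, g (D.inU u) = h (D.inU u)) → g = h)
    (hsnd : ∀ (g : Module.End A D.Mod) u, D.sndU (g (D.inU u)) = 0) :
    Nonempty (Module.End A D.Mod ≃ₐ[ℝ] ℝ) := by
  have : Nontrivial D.U := Module.nontrivial_of_finrank_eq_succ hU
  refine nonempty_algEquiv_real fun g => ?_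
  obtain ⟨p, q, h⟩ := exists_forall_map_inU hU g
  have hq (u : D.U) : q • u = 0 := by simpa [h] using hsnd g u
  refine ⟨p, hext fun u => ?_⟩
  have hqu : q • genJ • D.inU u = 0 := by
    rw [← order_smul_real_smul, ← map_smul, hq, map_zero, smul_zero]
  rw [h, hqu, add_zero]
  rfl

/-- The endomorphism which acts as `ȷ` on `U` and as `ρ` on `V`. -/
def rotation (hD : Module.IsTorsionBy A D.Mod genT) (ρ : D.V →ₗ[ℝ] D.V)
    (hX₁ : ∀ u, ρ (D.X₁ u) = D.X₂ u) (hX₂ : ∀ u, ρ (D.X₂ u) = -D.X₁ u)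
    (hY₁ : ∀ v, D.Y₁ (ρ v) = -D.Y₂ v) (hY₂ : ∀ v, D.Y₂ (ρ v) = D.Y₁ v) : Module.End A D.Mod :=
  lift hD hD (Algebra.lsmul ℝ ℝ D.Mod genJ ∘ₗ D.inU) (D.inV ∘ₗ ρ) (by simp) (by simp)
    (by simp [hX₁]) (by simp [hX₂]) (by simp [hY₁, hY₂, add_comm])

theorem nonempty_end_algEquiv_complex (hU : Module.finrank ℝ D.U = 1)
    (hext : ∀ {g h : Module.End A D.Mod}, (∀ u, g (D.inU u) = h (D.inU u)) → g = h)
    (hD : Module.IsTorsionBy A D.Mod genT) (ρ : D.V →ₗ[ℝ] D.V)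
    (hX₁ : ∀ u, ρ (D.X₁ u) = D.X₂ u) (hX₂ : ∀ u, ρ (D.X₂ u) = -D.X₁ u)
    (hY₁ : ∀ v, D.Y₁ (ρ v) = -D.Y₂ v) (hY₂ : ∀ v, D.Y₂ (ρ v) = D.Y₁ v) :
    Nonempty (Module.End A D.Mod ≃ₐ[ℝ] ℂ) := by
  have : Nontrivial D.U := Module.nontrivial_of_finrank_eq_succ hU
  have hrot (u : D.U) : rotation hD ρ hX₁ hX₂ hY₁ hY₂ (D.inU u) = genJ • D.inU u :=
    lift_inU _ _ _ _ _ _ _ _ _ u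
  refine nonempty_algEquiv_complex (i := rotation hD ρ hX₁ hX₂ hY₁ hY₂)
    (hext fun u => by simp [hrot]) fun g => ?_
  obtain ⟨p, q, h⟩ := exists_forall_map_inU hU g
  exact ⟨p, q, hext fun u => by simp [h, hrot]⟩

theorem sndU_map_inU_of_X₂_eq_zero (h₁ : Function.Injective D.X₁) (h₂ : D.X₂ = 0)
    (g : Module.End A D.Mod) (u : D.U) : D.sndU (g (D.inU u)) = 0 := by
  obtain ⟨a, b, hg⟩ := exists_map_inU g u
  have h : genX • genJ • g (D.inU u) = 0 := by
    rw [← map_smul, ← map_smul, genX_smul_genJ_smul_inU, h₂, LinearMap.zero_apply, map_zero,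
      map_zero]
  have hb : D.X₁ b = 0 := by simpa [hg, h₂] using congrArg D.projV h
  simpa [hg] using (map_eq_zero_iff D.X₁ h₁).mp hb

theorem sndU_map_inU_of_Y₂_eq_zero (h₁ : Function.Surjective D.Y₁) (h₂ : D.Y₂ = 0)
    (g : Module.End A D.Mod) (u : D.U) : D.sndU (g (D.inU u)) = 0 := by
  have hy (v : D.V) : genY • D.inV v = D.inU (D.Y₁ v) := by simp [h₂]
  obtain ⟨v, rfl⟩ := h₁ u
  obtain ⟨c, hc⟩ := exists_map_inV g v
  rw [← hy, map_smul, hc, hy, sndU_inU]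

end Diagram

theorem surjective_X_diagX₁ : Function.Surjective diagX₁.X := fun v =>
  ⟨(v, (0 : ℝ)), add_zero (M := ℝ) v⟩

theorem surjective_X_diagX₂ : Function.Surjective diagX₂.X := fun v =>
  ⟨v, Prod.ext (add_zero v.1) (zero_add v.2)⟩

theorem injective_Y_diagY₁ : Function.Injective diagY₁.Y := fun _ _ h => congrArg Prod.fst h

theorem injective_Y_diagY₂ : Function.Injective diagY₂.Y := fun _ _ h => h

theorem nonempty_end_diagX₁ : Nonempty (Module.End A diagX₁.Mod ≃ₐ[ℝ] ℝ) :=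
  Diagram.nonempty_end_algEquiv_real (Module.finrank_self ℝ)
    (Diagram.hom_ext_of_surjective_X surjective_X_diagX₁)
    (Diagram.sndU_map_inU_of_X₂_eq_zero Function.injective_id rfl)

theorem nonempty_end_diagY₁ : Nonempty (Module.End A diagY₁.Mod ≃ₐ[ℝ] ℝ) :=
  Diagram.nonempty_end_algEquiv_real (Module.finrank_self ℝ)
    (Diagram.hom_ext_of_injective_Y injective_Y_diagY₁)
    (Diagram.sndU_map_inU_of_Y₂_eq_zero Function.surjective_id rfl)

theorem nonempty_end_diagX₂ : Nonempty (Module.End A diagX₂.Mod ≃ₐ[ℝ] ℂ) :=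
  Diagram.nonempty_end_algEquiv_complex (Module.finrank_self ℝ)
    (Diagram.hom_ext_of_surjective_X surjective_X_diagX₂) isTorsionBy_diagX₂
    ((-LinearMap.snd ℝ ℝ ℝ).prod (LinearMap.fst ℝ ℝ ℝ))
    (fun _ => Prod.ext neg_zero rfl) (fun _ => Prod.ext rfl neg_zero.symm)
    (fun _ => neg_zero.symm) (fun _ => rfl)

theorem nonempty_end_diagY₂ : Nonempty (Module.End A diagY₂.Mod ≃ₐ[ℝ] ℂ) :=
  Diagram.nonempty_end_algEquiv_complex (Module.finrank_self ℝ)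
    (Diagram.hom_ext_of_injective_Y injective_Y_diagY₂) isTorsionBy_diagY₂
    ((-LinearMap.snd ℝ ℝ ℝ).prod (LinearMap.fst ℝ ℝ ℝ))
    (fun _ => map_zero _) (fun _ => (map_zero _).trans neg_zero.symm)
    (fun _ => rfl) (fun _ => rfl)

/-! ### Schurian modules -/

section Schurian

variable {M N : Type*} [AddCommGroup M] [Module A M] [AddCommGroup N] [Module A N]

theorem isSchurian_of_isSimpleModule [IsSimpleModule A M] : IsSchurian M := by
  have := IsSimpleModule.nontrivial A M
  exact ⟨inferInstance, fun g hg => (Module.End.isUnit_iff g).mpr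
    (LinearMap.bijective_of_ne_zero hg)⟩

theorem isSchurian_of_algEquiv [Module ℝ M] [IsScalarTower ℝ A M] {K : Type*}
    [DivisionRing K] [Algebra ℝ K] (φ : Module.End A M ≃ₐ[ℝ] K) : IsSchurian M := by
  refine ⟨φ.symm.injective.nontrivial, fun g hg => ?_⟩
  rw [← MulEquiv.isUnit_map φ, isUnit_iff_ne_zero]
  exact (map_ne_zero_iff φ φ.injective).mpr hg

theorem IsSchurian.nontrivial (hM : IsSchurian M) : Nontrivial M := by
  have := hM.1
  by_contra h
  rw [not_nontrivial_iff_subsingleton] at h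
  exact false_of_nontrivial_of_subsingleton (Module.End A M)

theorem IsSchurian.bijective (hM : IsSchurian M) {g : Module.End A M} (hg : g ≠ 0) :
    Function.Bijective g :=
  (Module.End.isUnit_iff g).mp (hM.2 g hg)

theorem IsSchurian.nonempty_equiv_of_comp_ne_zero (hM : IsSchurian M) {L : N →ₗ[A] M}
    {P : M →ₗ[A] N} (hL : Function.Injective L) (h : L ∘ₗ P ≠ 0) : Nonempty (M ≃ₗ[A] N) :=
  have hsurj : Function.Surjective (L ∘ P) := (hM.bijective h).surjective
  ⟨(LinearEquiv.ofBijective L ⟨hL, hsurj.of_comp⟩).symm⟩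

theorem IsSchurian.nonempty_equiv_of_isSimpleModule [IsSimpleModule A N] (hM : IsSchurian M)
    {L : N →ₗ[A] M} {P : M →ₗ[A] N} (hL : L ≠ 0) (hP : P ≠ 0) : Nonempty (M ≃ₗ[A] N) := by
  refine hM.nonempty_equiv_of_comp_ne_zero (P := P) (LinearMap.injective_of_ne_zero hL)
    fun h => hL ?_
  exact (LinearMap.cancel_right (LinearMap.surjective_of_ne_zero hP)).mp
    (h.trans (LinearMap.zero_comp P).symm)

theorem IsSchurian.nonempty_equiv (hM : IsSchurian M) (hN : IsSchurian N) {L : N →ₗ[A] M}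
    {P : M →ₗ[A] N} {n : N} (h : P (L n) ≠ 0) : Nonempty (M ≃ₗ[A] N) := by
  have hPL : Function.Bijective (P ∘ₗ L) :=
    hN.bijective fun h0 => h (LinearMap.congr_fun h0 n)
  refine hM.nonempty_equiv_of_comp_ne_zero (P := P) (Function.Injective.of_comp hPL.injective)
    fun hLP => h ?_
  obtain ⟨n', hn'⟩ := hPL.surjective n
  have hLn : L n = 0 := by rw [← hn']; exact LinearMap.congr_fun hLP (L n')
  rw [hLn, map_zero]

theorem IsSchurian.nonempty_equiv_of_fstU (hM : IsSchurian M) {D : Diagram} (hD : IsSchurian D.Mod)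
    {L : D.Mod →ₗ[A] M} {P : M →ₗ[A] D.Mod} {u : D.U} (h : D.fstU (P (L (D.inU u))) ≠ 0) :
    Nonempty (M ≃ₗ[A] D.Mod) :=
  hM.nonempty_equiv hD (n := D.inU u) fun h0 => h (by rw [h0, map_zero])

theorem IsSchurian.isTorsionBy_genT [Module ℝ M] [IsScalarTower ℝ A M] [FiniteDimensional ℝ M]
    (hM : IsSchurian M) : Module.IsTorsionBy A M genT := by
  let T : Module.End A M :=
    { toFun := fun m => genT • m
      map_add' := smul_add genT
      map_smul' := fun a m => by
        rw [RingHom.id_apply, smul_smul, smul_smul, genT, scalarHom_mul_comm] }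
  suffices T = 0 from fun m => LinearMap.congr_fun this m
  by_contra hT
  let _ : Module R M := Module.compHom M scalarHom
  have _ : IsScalarTower ℝ R M := ⟨fun c p m => by
    change scalarHom (c • p) • m = c • scalarHom p • m
    rw [Algebra.smul_def, map_mul, mul_smul, scalarHom_algebraMap, algebraMap_smul]⟩
  have _ : Module.Finite R M := Module.Finite.of_restrictScalars_finite ℝ R M
  have := hM.nontrivial
  have hX : (PowerSeries.X : R) ∈ (Module.annihilator R M).jacobson :=
    IsLocalRing.maximalIdeal_le_jacobson _ PowerSeries.X_prime.not_isUnit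
  refine Submodule.top_ne_pointwise_smul_of_mem_jacobson_annihilator hX (Eq.symm ?_)
  refine eq_top_iff.mpr fun m _ => ?_
  obtain ⟨n, rfl⟩ := (hM.bijective hT).surjective m
  exact Submodule.smul_mem_pointwise_smul n PowerSeries.X ⊤ trivial

end Schurian

theorem isSchurian_diagY₁ : IsSchurian diagY₁.Mod :=
  nonempty_end_diagY₁.elim isSchurian_of_algEquiv

theorem isSchurian_diagX₁ : IsSchurian diagX₁.Mod :=
  nonempty_end_diagX₁.elim isSchurian_of_algEquiv

theorem isSchurian_diagY₂ : IsSchurian diagY₂.Mod :=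
  nonempty_end_diagY₂.elim isSchurian_of_algEquiv

theorem isSchurian_diagX₂ : IsSchurian diagX₂.Mod :=
  nonempty_end_diagX₂.elim isSchurian_of_algEquiv

theorem isSchurian_sixDiagrams (i : Fin 6) : IsSchurian (sixDiagrams i).Mod := by
  fin_cases i
  exacts [isSchurian_of_isSimpleModule (M := diagS.Mod),
    isSchurian_of_isSimpleModule (M := diagT.Mod), isSchurian_diagY₁, isSchurian_diagX₁,
    isSchurian_diagY₂, isSchurian_diagX₂]

/-! ### Recognition of the six modules -/

theorem exists_dual_apply_eq {K V W : Type*} [Field K] [AddCommGroup V] [Module K V]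
    [AddCommGroup W] [Module K W] (f : V →ₗ[K] W) {l : Module.Dual K V}
    (hl : ∀ v, f v = 0 → l v = 0) : ∃ μ : Module.Dual K W, ∀ v, μ (f v) = l v := by
  have h : l ∈ LinearMap.range f.dualMap := by
    rw [LinearMap.range_dualMap_eq_dualAnnihilator_ker, Submodule.mem_dualAnnihilator]
    exact hl
  obtain ⟨μ, rfl⟩ := h
  exact ⟨μ, fun _ => rfl⟩

namespace IsSchurian

variable {M : Type*} [AddCommGroup M] [Module ℝ M] [Module A M] [IsScalarTower ℝ A M]

theorem nonempty_equiv_diagS (hM : IsSchurian M) (ht : Module.IsTorsionBy A M genT) {w m₀ : M}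
    (hw : w ≠ 0) (hew : idemE • w = w) (hxw : genX • w = 0) (hxjw : genX • genJ • w = 0)
    {l : Module.Dual ℝ M} (hl : l (idemE • m₀) ≠ 0) (hly : ∀ m, l (genY • m) = 0)
    (hljy : ∀ m, l (genJ • genY • m) = 0) : Nonempty (M ≃ₗ[A] diagS.Mod) := by
  let L : diagS.Mod →ₗ[A] M := Diagram.lift isTorsionBy_diagS ht
    (LinearMap.toSpanSingleton ℝ M w) 0
    (fun (c : ℝ) => show idemE • c • w = c • w by rw [order_smul_real_smul, hew])
    (fun _ => smul_zero idemE)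
    (fun (c : ℝ) => show genX • c • w = 0 by rw [order_smul_real_smul, hxw, smul_zero])
    (fun (c : ℝ) => show genX • genJ • c • w = 0 by
      simp only [order_smul_real_smul, hxjw, smul_zero])
    (fun _ => show genY • (0 : M) = (0 : ℝ) • w + genJ • (0 : ℝ) • w by simp)
  let P : M →ₗ[A] diagS.Mod := Diagram.colift ht isTorsionBy_diagS l 0 (fun _ => rfl)
    (fun _ => (sub_self _).symm) hly (fun m => neg_eq_zero.mpr (hljy m))
  have hL : L (diagS.inU (1 : ℝ)) = w := (Diagram.lift_inU ..).trans (one_smul ℝ w)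
  have hP : diagS.fstU (P m₀) = l (idemE • m₀) := Diagram.fstU_colift ..
  refine hM.nonempty_equiv_of_isSimpleModule (L := L) (P := P) ?_ ?_
  · intro h
    exact hw (by rw [← hL, h, LinearMap.zero_apply])
  · intro h
    exact hl (by rw [← hP, h, LinearMap.zero_apply]; rfl)

theorem nonempty_equiv_diagT (hM : IsSchurian M) (ht : Module.IsTorsionBy A M genT) {v m₀ : M}
    (hv : v ≠ 0) (hev : idemE • v = 0) (hyv : genY • v = 0)
    {l : Module.Dual ℝ M} (hl : l (idemF • m₀) ≠ 0) (hlx : ∀ m, l (genX • m) = 0) :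
    Nonempty (M ≃ₗ[A] diagT.Mod) := by
  let L : diagT.Mod →ₗ[A] M := Diagram.lift isTorsionBy_diagT ht
    0 (LinearMap.toSpanSingleton ℝ M v)
    (fun _ => smul_zero idemE)
    (fun (c : ℝ) => show idemE • c • v = 0 by rw [order_smul_real_smul, hev, smul_zero])
    (fun _ => show genX • (0 : M) = (0 : ℝ) • v by simp)
    (fun _ => show genX • genJ • (0 : M) = (0 : ℝ) • v by simp)
    (fun (c : ℝ) => show genY • c • v = 0 + genJ • 0 by simp [order_smul_real_smul, hyv])
  let P : M →ₗ[A] diagT.Mod := Diagram.colift ht isTorsionBy_diagT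
    0 (l ∘ₗ Algebra.lsmul ℝ ℝ M idemF)
    (fun m => show l (idemF • idemE • m) = 0 by simp)
    (fun m => show l (idemF • genX • m) = 0 - 0 by simp [hlx])
    (fun _ => rfl) (fun _ => neg_zero)
  have hL : L (diagT.inV (1 : ℝ)) = v := (Diagram.lift_inV ..).trans (one_smul ℝ v)
  have hP : diagT.projV (P m₀) = l (idemF • m₀) := Diagram.projV_colift ..
  refine hM.nonempty_equiv_of_isSimpleModule (L := L) (P := P) ?_ ?_
  · intro h
    exact hv (by rw [← hL, h, LinearMap.zero_apply])
  · intro h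
    exact hl (by rw [← hP, h, LinearMap.zero_apply]; rfl)

theorem nonempty_equiv_diagY₁ (hM : IsSchurian M) (ht : Module.IsTorsionBy A M genT)
    (hx : ∀ m : M, genX • m = 0) {m₀ : M} {l : Module.Dual ℝ M} (hl : l (genY • m₀) ≠ 0)
    (hljy : ∀ m, l (genJ • genY • m) = 0) : Nonempty (M ≃ₗ[A] diagY₁.Mod) := by
  let L : diagY₁.Mod →ₗ[A] M := Diagram.lift isTorsionBy_diagY₁ ht
    (LinearMap.toSpanSingleton ℝ M (genY • m₀)) (LinearMap.toSpanSingleton ℝ M (idemF • m₀))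
    (fun (c : ℝ) => show idemE • c • genY • m₀ = c • genY • m₀ by simp [order_smul_real_smul])
    (fun (c : ℝ) => show idemE • c • idemF • m₀ = 0 by simp [order_smul_real_smul])
    (fun _ => (hx _).trans (zero_smul ℝ _).symm)
    (fun _ => (hx _).trans (zero_smul ℝ _).symm)
    (fun (c : ℝ) => show genY • c • idemF • m₀ = c • genY • m₀ + genJ • (0 : ℝ) • genY • m₀ by
      simp [order_smul_real_smul])
  let P : M →ₗ[A] diagY₁.Mod := Diagram.colift ht isTorsionBy_diagY₁
    l (l ∘ₗ Algebra.lsmul ℝ ℝ M genY)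
    (fun m => show l (genY • idemE • m) = 0 by simp)
    (fun m => show l (genY • genX • m) = 0 - 0 by simp [hx])
    (fun _ => rfl) (fun m => neg_eq_zero.mpr (hljy m))
  have hL : L (diagY₁.inU (1 : ℝ)) = genY • m₀ := (Diagram.lift_inU ..).trans (one_smul ℝ _)
  have hP (m : M) : diagY₁.fstU (P m) = l (idemE • m) := Diagram.fstU_colift ..
  refine hM.nonempty_equiv_of_fstU isSchurian_diagY₁ (L := L) (P := P) (u := (1 : ℝ)) ?_
  rwa [hL, hP, idemE_smul_genY_smul]

theorem nonempty_equiv_diagY₂ (hM : IsSchurian M) (ht : Module.IsTorsionBy A M genT)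
    (hx : ∀ m : M, genX • m = 0) {m₁ m₂ : M} (hm : genY • m₂ = genJ • genY • m₁)
    {l : Module.Dual ℝ M} (hl : l (genY • m₁) ≠ 0) : Nonempty (M ≃ₗ[A] diagY₂.Mod) := by
  let L : diagY₂.Mod →ₗ[A] M := Diagram.lift isTorsionBy_diagY₂ ht
    (LinearMap.toSpanSingleton ℝ M (genY • m₁))
    ((LinearMap.toSpanSingleton ℝ M (idemF • m₁)).coprod
      (LinearMap.toSpanSingleton ℝ M (idemF • m₂)))
    (fun (c : ℝ) => show idemE • c • genY • m₁ = c • genY • m₁ by simp [order_smul_real_smul])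
    (fun (c : ℝ × ℝ) => show idemE • (c.1 • idemF • m₁ + c.2 • idemF • m₂) = 0 by
      simp [order_smul_real_smul])
    (fun _ => (hx _).trans (map_zero _).symm)
    (fun _ => (hx _).trans (map_zero _).symm)
    (fun (c : ℝ × ℝ) => show genY • (c.1 • idemF • m₁ + c.2 • idemF • m₂)
        = c.1 • genY • m₁ + genJ • c.2 • genY • m₁ by
      simp [order_smul_real_smul, hm])
  let P : M →ₗ[A] diagY₂.Mod := Diagram.colift ht isTorsionBy_diagY₂
    l ((l ∘ₗ Algebra.lsmul ℝ ℝ M genY).prod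
      (-(l ∘ₗ Algebra.lsmul ℝ ℝ M genJ ∘ₗ Algebra.lsmul ℝ ℝ M genY)))
    (fun m => Prod.ext (show l (genY • idemE • m) = 0 by simp)
      (show -l (genJ • genY • idemE • m) = 0 by simp))
    (fun m => Prod.ext (show l (genY • genX • m) = 0 - 0 by simp [hx])
      (show -l (genJ • genY • genX • m) = 0 - 0 by simp [hx]))
    (fun _ => rfl) (fun _ => rfl)
  have hL : L (diagY₂.inU (1 : ℝ)) = genY • m₁ := (Diagram.lift_inU ..).trans (one_smul ℝ _)
  have hP (m : M) : diagY₂.fstU (P m) = l (idemE • m) := Diagram.fstU_colift ..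
  refine hM.nonempty_equiv_of_fstU isSchurian_diagY₂ (L := L) (P := P) (u := (1 : ℝ)) ?_
  rwa [hL, hP, idemE_smul_genY_smul]

theorem nonempty_equiv_diagX₁ (hM : IsSchurian M) (ht : Module.IsTorsionBy A M genT)
    (hy : ∀ m : M, genY • m = 0) {w : M} (hew : idemE • w = w) (hxjw : genX • genJ • w = 0)
    (hxw : genX • w ≠ 0) : Nonempty (M ≃ₗ[A] diagX₁.Mod) := by
  obtain ⟨l, hl⟩ := Module.Projective.exists_dual_ne_zero ℝ hxw
  let L : diagX₁.Mod →ₗ[A] M := Diagram.lift isTorsionBy_diagX₁ ht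
    (LinearMap.toSpanSingleton ℝ M w) (LinearMap.toSpanSingleton ℝ M (genX • w))
    (fun (c : ℝ) => show idemE • c • w = c • w by rw [order_smul_real_smul, hew])
    (fun (c : ℝ) => show idemE • c • genX • w = 0 by simp [order_smul_real_smul])
    (fun (c : ℝ) => show genX • c • w = c • genX • w by rw [order_smul_real_smul])
    (fun (c : ℝ) => show genX • genJ • c • w = (0 : ℝ) • genX • w by
      simp [order_smul_real_smul, hxjw])
    (fun _ => (hy _).trans (show 0 = (0 : ℝ) • w + genJ • (0 : ℝ) • w by simp))
  let P : M →ₗ[A] diagX₁.Mod := Diagram.colift ht isTorsionBy_diagX₁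
    (l ∘ₗ Algebra.lsmul ℝ ℝ M genX) (l ∘ₗ Algebra.lsmul ℝ ℝ M idemF)
    (fun m => show l (idemF • idemE • m) = 0 by simp)
    (fun m => show l (idemF • genX • m) = l (genX • idemE • m) - 0 by simp)
    (fun m => show l (genX • genY • m) = 0 by simp [hy])
    (fun m => show -l (genX • genJ • genY • m) = 0 by simp)
  have hL : L (diagX₁.inU (1 : ℝ)) = w := (Diagram.lift_inU ..).trans (one_smul ℝ w)
  have hP (m : M) : diagX₁.fstU (P m) = l (genX • idemE • m) := Diagram.fstU_colift ..
  refine hM.nonempty_equiv_of_fstU isSchurian_diagX₁ (L := L) (P := P) (u := (1 : ℝ)) ?_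
  rwa [hL, hP, genX_smul_idemE_smul]

theorem nonempty_equiv_diagX₂ (hM : IsSchurian M) (ht : Module.IsTorsionBy A M genT)
    (hy : ∀ m : M, genY • m = 0) {w : M} (hew : idemE • w = w) {l : Module.Dual ℝ M}
    (hl : l w ≠ 0) (hle : ∀ m, genX • m = 0 → l (idemE • m) = 0)
    (hlj : ∀ m, genX • m = 0 → l (genJ • m) = 0) : Nonempty (M ≃ₗ[A] diagX₂.Mod) := by
  obtain ⟨μ, hμ⟩ := exists_dual_apply_eq (Algebra.lsmul ℝ ℝ M genX)
    (l := l ∘ₗ Algebra.lsmul ℝ ℝ M idemE) hle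
  obtain ⟨ν, hν⟩ := exists_dual_apply_eq (Algebra.lsmul ℝ ℝ M genX)
    (l := l ∘ₗ Algebra.lsmul ℝ ℝ M genJ) hlj
  let L : diagX₂.Mod →ₗ[A] M := Diagram.lift isTorsionBy_diagX₂ ht
    (LinearMap.toSpanSingleton ℝ M w)
    ((LinearMap.toSpanSingleton ℝ M (genX • w)).coprod
      (LinearMap.toSpanSingleton ℝ M (genX • genJ • w)))
    (fun (c : ℝ) => show idemE • c • w = c • w by rw [order_smul_real_smul, hew])
    (fun (c : ℝ × ℝ) => show idemE • (c.1 • genX • w + c.2 • genX • genJ • w) = 0 by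
      simp [order_smul_real_smul])
    (fun (c : ℝ) => show genX • c • w = c • genX • w + (0 : ℝ) • genX • genJ • w by
      simp [order_smul_real_smul])
    (fun (c : ℝ) => show genX • genJ • c • w = (0 : ℝ) • genX • w + c • genX • genJ • w by
      simp [order_smul_real_smul])
    (fun _ => (hy _).trans (show 0 = (0 : ℝ) • w + genJ • (0 : ℝ) • w by simp))
  let P : M →ₗ[A] diagX₂.Mod := Diagram.colift ht isTorsionBy_diagX₂
    l ((μ ∘ₗ Algebra.lsmul ℝ ℝ M idemF).prod (-(ν ∘ₗ Algebra.lsmul ℝ ℝ M idemF)))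
    (fun m => Prod.ext (show μ (idemF • idemE • m) = 0 by simp)
      (show -ν (idemF • idemE • m) = 0 by simp))
    (fun m => Prod.ext
      (show μ (idemF • genX • m) = l (idemE • m) - 0 by
        rw [idemF_smul_genX_smul, sub_zero]; exact hμ m)
      (show -ν (idemF • genX • m) = 0 - l (genJ • m) by
        rw [idemF_smul_genX_smul, zero_sub, neg_inj]; exact hν m))
    (fun m => show l (genY • m) = 0 by simp [hy])
    (fun m => show -l (genJ • genY • m) = 0 by simp [hy])
  have hL : L (diagX₂.inU (1 : ℝ)) = w := (Diagram.lift_inU ..).trans (one_smul ℝ w)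
  have hP (m : M) : diagX₂.fstU (P m) = l (idemE • m) := Diagram.fstU_colift ..
  refine hM.nonempty_equiv_of_fstU isSchurian_diagX₂ (L := L) (P := P) (u := (1 : ℝ)) ?_
  rwa [hL, hP, hew]

end IsSchurian

/-! ### Classification -/

namespace IsSchurian

variable {M : Type*} [AddCommGroup M] [Module ℝ M] [Module A M] [IsScalarTower ℝ A M]

theorem exists_equiv_of_genX_genY (hM : IsSchurian M) (ht : Module.IsTorsionBy A M genT)
    {m₀ m₁ : M} (hx : genX • m₀ ≠ 0) (hy : genY • m₁ ≠ 0) :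
    ∃ i, Nonempty (M ≃ₗ[A] (sixDiagrams i).Mod) := by
  obtain ⟨l, hl⟩ := Module.Projective.exists_dual_ne_zero ℝ hx
  refine ⟨0, hM.nonempty_equiv_diagS ht hy (m₀ := m₀) (idemE_smul_genY_smul m₁)
    (genX_smul_genY_smul ht m₁) (genX_smul_genJ_smul_genY_smul m₁)
    (l := l ∘ₗ Algebra.lsmul ℝ ℝ M genX) ?_ (fun m => ?_) fun m => ?_⟩
  · change l (genX • idemE • m₀) ≠ 0
    rwa [genX_smul_idemE_smul]
  · change l (genX • genY • m) = 0
    rw [genX_smul_genY_smul ht, map_zero]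
  · change l (genX • genJ • genY • m) = 0
    rw [genX_smul_genJ_smul_genY_smul, map_zero]

theorem exists_equiv_of_genX_eq_zero (hM : IsSchurian M) (ht : Module.IsTorsionBy A M genT)
    (hx : ∀ m : M, genX • m = 0) {m₀ : M} (hy : genY • m₀ ≠ 0) :
    ∃ i, Nonempty (M ≃ₗ[A] (sixDiagrams i).Mod) := by
  by_cases hyjy : genY • m₀ ∈ LinearMap.range (Algebra.lsmul ℝ ℝ M (genJ * genY))
  · obtain ⟨m₁, hm₁ : (genJ * genY) • m₁ = genY • m₀⟩ := hyjy
    rw [mul_smul] at hm₁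
    have hy₁ : genY • m₁ ≠ 0 := fun h => hy (by rw [← hm₁, h, smul_zero])
    obtain ⟨l, hl⟩ := Module.Projective.exists_dual_ne_zero ℝ hy₁
    exact ⟨4, hM.nonempty_equiv_diagY₂ ht hx hm₁.symm hl⟩
  · obtain ⟨l, hl, hljy⟩ := Submodule.exists_le_ker_of_notMem hyjy
    refine ⟨2, hM.nonempty_equiv_diagY₁ ht hx hl fun m => ?_⟩
    rw [← mul_smul]
    exact hljy ⟨m, rfl⟩

theorem exists_equiv_of_genY_eq_zero (hM : IsSchurian M) (ht : Module.IsTorsionBy A M genT)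
    (hy : ∀ m : M, genY • m = 0) {m₀ : M} (hx : genX • m₀ ≠ 0) :
    ∃ i, Nonempty (M ≃ₗ[A] (sixDiagrams i).Mod) := by
  let K := LinearMap.ker (Algebra.lsmul ℝ ℝ M genX)
  by_cases h : idemE • m₀ ∈
      K.map (Algebra.lsmul ℝ ℝ M idemE) ⊔ K.map (Algebra.lsmul ℝ ℝ M genJ)
  · obtain ⟨_, ⟨k₁, hk₁ : genX • k₁ = 0, rfl⟩, _, ⟨k₂, hk₂ : genX • k₂ = 0, rfl⟩,
      hk : idemE • k₁ + genJ • k₂ = idemE • m₀⟩ := Submodule.mem_sup.mp h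
    have hxk : genX • genJ • k₂ = genX • m₀ := by
      have h := congrArg (genX • ·) hk
      simpa [hk₁] using h
    exact ⟨3, hM.nonempty_equiv_diagX₁ ht hy (idemE_smul_genJ_smul k₂) (by simp [hk₂])
      (hxk ▸ hx)⟩
  · obtain ⟨l, hl, hlK⟩ := Submodule.exists_le_ker_of_notMem h
    exact ⟨5, hM.nonempty_equiv_diagX₂ ht hy (idemE_smul_idemE_smul m₀) hl
      (fun m hm => hlK (Submodule.mem_sup_left ⟨m, hm, rfl⟩))
      fun m hm => hlK (Submodule.mem_sup_right ⟨m, hm, rfl⟩)⟩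

theorem exists_equiv_of_genX_genY_eq_zero (hM : IsSchurian M)
    (ht : Module.IsTorsionBy A M genT) (hx : ∀ m : M, genX • m = 0)
    (hy : ∀ m : M, genY • m = 0) : ∃ i, Nonempty (M ≃ₗ[A] (sixDiagrams i).Mod) := by
  by_cases he : ∀ m : M, idemE • m = 0
  · have := hM.nontrivial
    obtain ⟨v, hv⟩ := exists_ne (0 : M)
    obtain ⟨l, hl⟩ := Module.Projective.exists_dual_ne_zero ℝ hv
    have hfv : idemF • v = v := by simpa [he] using idemE_smul_add_idemF_smul v
    exact ⟨1, hM.nonempty_equiv_diagT ht hv (he v) (hy v) (m₀ := v) (l := l) (by rwa [hfv])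
      fun m => by rw [hx, map_zero]⟩
  · obtain ⟨m₀, hm₀⟩ := not_forall.mp he
    obtain ⟨l, hl⟩ := Module.Projective.exists_dual_ne_zero ℝ hm₀
    exact ⟨0, hM.nonempty_equiv_diagS ht hm₀ (idemE_smul_idemE_smul m₀) (hx _) (hx _) hl
      (fun m => by rw [hy, map_zero]) fun m => by rw [hy, smul_zero, map_zero]⟩

theorem exists_equiv [FiniteDimensional ℝ M] (hM : IsSchurian M) :
    ∃ i, Nonempty (M ≃ₗ[A] (sixDiagrams i).Mod) := by
  have ht := hM.isTorsionBy_genT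
  by_cases hx : ∀ m : M, genX • m = 0 <;> by_cases hy : ∀ m : M, genY • m = 0
  · exact hM.exists_equiv_of_genX_genY_eq_zero ht hx hy
  · obtain ⟨m₀, hm₀⟩ := not_forall.mp hy
    exact hM.exists_equiv_of_genX_eq_zero ht hx hm₀
  · obtain ⟨m₀, hm₀⟩ := not_forall.mp hx
    exact hM.exists_equiv_of_genY_eq_zero ht hy hm₀
  · obtain ⟨m₀, hm₀⟩ := not_forall.mp hx
    obtain ⟨m₁, hm₁⟩ := not_forall.mp hy
    exact hM.exists_equiv_of_genX_genY ht hm₀ hm₁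

end IsSchurian

/-! ### The six modules are pairwise non-isomorphic -/

theorem Diagram.genY_smul_eq_zero_iff {D : Diagram} :
    (∀ m : D.Mod, genY • m = 0) ↔ D.Y₁ = 0 ∧ D.Y₂ = 0 := by
  refine ⟨fun h => ⟨LinearMap.ext fun v => ?_, LinearMap.ext fun v => ?_⟩, fun ⟨h₁, h₂⟩ m => ?_⟩
  · simpa using congrArg D.fstU ((genY_smul_inV v).symm.trans (h _))
  · simpa using congrArg D.sndU ((genY_smul_inV v).symm.trans (h _))
  · obtain ⟨u₁, u₂, v, rfl⟩ := exists_eq m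
    simp [h₁, h₂]

theorem genY_smul_eq_zero_iff (i : Fin 6) :
    (∀ m : (sixDiagrams i).Mod, genY • m = 0) ↔ ![true, true, false, true, false, true] i := by
  have hid : (LinearMap.id : ℝ →ₗ[ℝ] ℝ) ≠ 0 := one_ne_zero
  have hfst : LinearMap.fst ℝ ℝ ℝ ≠ 0 := fun h => one_ne_zero (LinearMap.congr_fun h (1, 0))
  rw [Diagram.genY_smul_eq_zero_iff]
  fin_cases i
  exacts [iff_of_true ⟨rfl, rfl⟩ rfl, iff_of_true ⟨rfl, rfl⟩ rfl,
    iff_of_false (fun h => hid h.1) Bool.false_ne_true, iff_of_true ⟨rfl, rfl⟩ rfl,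
    iff_of_false (fun h => hfst h.1) Bool.false_ne_true, iff_of_true ⟨rfl, rfl⟩ rfl]

theorem finrank_sixDiagrams (i : Fin 6) :
    Module.finrank ℝ (sixDiagrams i).Mod = ![2, 1, 3, 3, 4, 4] i := by
  have h (D : Diagram) {u v : ℕ} (hu : Module.finrank ℝ D.U = u) (hv : Module.finrank ℝ D.V = v) :
      Module.finrank ℝ D.Mod = 2 * u + v := by rw [Diagram.finrank_mod, hu, hv]
  have h₀ : Module.finrank ℝ PUnit = 0 := Module.finrank_zero_of_subsingleton
  have h₁ : Module.finrank ℝ ℝ = 1 := Module.finrank_self ℝ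
  have h₂ : Module.finrank ℝ (ℝ × ℝ) = 2 := by simp
  fin_cases i
  exacts [h diagS h₁ h₀, h diagT h₀ h₁, h diagY₁ h₁ h₁, h diagX₁ h₁ h₁, h diagY₂ h₁ h₂,
    h diagX₂ h₁ h₂]

theorem eq_of_equiv {i j : Fin 6} (φ : (sixDiagrams i).Mod ≃ₗ[A] (sixDiagrams j).Mod) :
    i = j := by
  have hd := (φ.restrictScalars ℝ).finrank_eq
  have hy : (∀ m : (sixDiagrams i).Mod, genY • m = 0) ↔
      ∀ m : (sixDiagrams j).Mod, genY • m = 0 := by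
    rw [φ.surjective.forall]
    simp only [← map_smul, map_eq_zero_iff φ φ.injective]
  rw [finrank_sixDiagrams, finrank_sixDiagrams] at hd
  rw [genY_smul_eq_zero_iff, genY_smul_eq_zero_iff] at hy
  clear φ
  revert i j
  decide

end RealGelfand

end

theorem theoremT :
    -- the six modules: two simple ones, two of length two, two of length three
    (IsSimpleModule RealGelfand.A RealGelfand.diagS.Mod ∧
      RealGelfand.HasDimVector RealGelfand.diagS.Mod 1 0) ∧
    (IsSimpleModule RealGelfand.A RealGelfand.diagT.Mod ∧
      RealGelfand.HasDimVector RealGelfand.diagT.Mod 0 1) ∧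
    (Module.length RealGelfand.A RealGelfand.diagY₁.Mod = 2 ∧
      Nonempty (Module.End RealGelfand.A RealGelfand.diagY₁.Mod ≃ₐ[ℝ] ℝ)) ∧
    (Module.length RealGelfand.A RealGelfand.diagX₁.Mod = 2 ∧
      Nonempty (Module.End RealGelfand.A RealGelfand.diagX₁.Mod ≃ₐ[ℝ] ℝ)) ∧
    (Module.length RealGelfand.A RealGelfand.diagY₂.Mod = 3 ∧
      Nonempty (Module.End RealGelfand.A RealGelfand.diagY₂.Mod ≃ₐ[ℝ] ℂ)) ∧
    (Module.length RealGelfand.A RealGelfand.diagX₂.Mod = 3 ∧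
      Nonempty (Module.End RealGelfand.A RealGelfand.diagX₂.Mod ≃ₐ[ℝ] ℂ)) ∧
    -- they are Schurian and pairwise non-isomorphic
    (∀ i, RealGelfand.IsSchurian (RealGelfand.sixDiagrams i).Mod) ∧
    (∀ i j, Nonempty ((RealGelfand.sixDiagrams i).Mod ≃ₗ[RealGelfand.A]
      (RealGelfand.sixDiagrams j).Mod) → i = j) ∧
    -- every finite dimensional Schurian module is isomorphic to one of them
    (∀ (M : Type*) [AddCommGroup M] [Module ℝ M] [Module RealGelfand.A M]
      [IsScalarTower ℝ RealGelfand.A M] [FiniteDimensional ℝ M], RealGelfand.IsSchurian M →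
        ∃ i, Nonempty (M ≃ₗ[RealGelfand.A] (RealGelfand.sixDiagrams i).Mod)) := by
  open RealGelfand in
  exact ⟨⟨isSimpleModule_diagS, hasDimVector_diagS⟩, ⟨isSimpleModule_diagT, hasDimVector_diagT⟩,
    ⟨length_diagY₁, nonempty_end_diagY₁⟩, ⟨length_diagX₁, nonempty_end_diagX₁⟩,
    ⟨length_diagY₂, nonempty_end_diagY₂⟩, ⟨length_diagX₂, nonempty_end_diagX₂⟩,
    isSchurian_sixDiagrams, fun _ _ ⟨φ⟩ => eq_of_equiv φ, fun _ _ _ _ _ _ h => h.exists_equiv⟩
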